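/- Use coordinates $(u,r,\theta,\phi)$ with $0<\theta<\pi$ and with $r$ in a nonempty open interval $J$ not containing $0$, and signature $(+,-,-,-)$. For real $M$ (mass), $\Lambda^*$ (cosmological constant), $a$ (rotation) and a $C^2$ function $e(r)$ on $J$ (charge), consider the variable-charged Reissner–Nordström–de Sitter metric $$ds^2=\Big(1-\frac{2M}{r}+\frac{e^2(r)}{r^2}-\frac{\Lambda^*r^2}{3}\Big)du^2+2\,du\,dr-r^2(d\theta^2+\sin^2\theta\,d\phi^2)$$ and the variable-charged Kerr–Newman–de Sitter metric $$ds^2=\Big(1-\frac{H}{R^2}\Big)du^2+2\,du\,dr+\frac{2aH}{R^2}\sin^2\theta\,du\,d\phi-2a\sin^2\theta\,dr\,d\phi-R^2d\theta^2-\frac{(r^2+a^2)^2-\Delta^*a^2\sin^2\theta}{R^2}\sin^2\theta\,d\phi^2,$$ where $R=r+ia\cos\theta$, $R^2$ in the metric denotes $|R|^2=r^2+a^2\cos^2\theta$, $H=2Mr-e^2(r)+\Lambda^*r^4/3$ and $\Delta^*=r^2+a^2-H$; in the first case put $R=r$. Both metrics are also used with $e^2(r)$ replaced by a real constant $C$.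 The null tetrad is given by the covectors $\ell=du-a\sin^2\theta\,d\phi$, $n=\frac{\Delta^*}{2|R|^2}(du-a\sin^2\theta\,d\phi)+dr$, $m=-\frac{1}{\sqrt2R}\big(-ia\sin\theta\,du+|R|^2d\theta+i(r^2+a^2)\sin\theta\,d\phi\big)$ and $\overline m$, with $a=0$ in the first case. Let $\Lambda=\frac1{24}R_{ab}g^{ab}$, where $R_{ab}$ has the sign for which de Sitter space satisfies $R_{ab}=\Lambda^*g_{ab}$. Write $\Lambda=\Lambda^{(C)}+\Lambda^{(E)}$ with cosmological part $\Lambda^{(C)}=\frac{\Lambda^*r^2}{6|R|^2}$ (so $\Lambda^*/6$ in the first case); $\Lambda^{(E)}$ is the electromagnetic part. An electromagnetic field of the metric is a $C^1$ two-form $F$ with $dF=0$, $\nabla_aF^{ab}=0$ and $$R_{ab}-\tfrac12R_{cd}g^{cd}\,g_{ab}=-\big(T^{(E)}_{ab}+T^{(C)}_{ab}\big),\qquad T^{(E)}_{ab}=-F_{ac}F_b{}^c+\tfrac14g_{ab}F_{cd}F^{cd},\qquad T^{(C)}_{ab}=2\rho\,\ell_{(a}n_{b)}+2p\,m_{(a}\overline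 m_{b)},$$ $\rho=\Lambda^*r^4/|R|^4$, $p=-\Lambda^*r^2(2|R|^2-r^2)/|R|^4$ (so $T^{(C)}=\Lambda^*g$ when $a=0$). Its Maxwell scalar is $\phi_1=\frac12F_{ab}(\ell^an^b+\overline m^am^b)$. We say that $\phi_1$ *has the standard form with constant* $C$ if every electromagnetic field of the metric satisfies $\phi_1=\omega\sqrt C/(\sqrt2\,\overline R^2)$ for some constant $\omega\in\mathbb C$ with $|\omega|=1$ (and $C\ge0$ if there is one), and for every real $e$ with $e^2=C$ some electromagnetic field of the metric has $\phi_1=e/(\sqrt2\,\overline R^2)$. **Theorem 1.** For each of the two families: (1) $\Lambda^{(E)}=-\dfrac{e'^2(r)+e(r)e''(r)}{12|R|^2}$, and $\Lambda^{(E)}$ vanishes identically if and only if $e^2(r)=2m_1r+C$ on $J$ for some real constants $m_1$, $C$. (2) If $e^2(r)=2m_1r+C$ on $J$, then the metric equals the metric of the same family (same $a$) with mass $M-m_1$, cosmological constant $\Lambda^*$ and $e^2$ replaced by the constant $C$, and these three parameters are uniquely determined. Its scalar $\Lambda$ is $\Lambda^{(C)}=\Lambda^*r^2/(6|R|^2)$,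 and $\phi_1$ has the standard form with constant $C$. (3) Start from mass $M$ and cosmological constant $\Lambda^*$, and repeat $n$ times the step in which the charge of the metric reached so far is replaced by a $C^2$ function $e_k(r)$ for which $\Lambda^{(E)}=0$ and the result is written as a member of the family with some constant squared charge $C_k$. Then $e_k^2(r)=2m_kr+C_k$ with real constants $m_k$ $(1\le k\le n)$, and after $k\le n$ steps the cosmological constant is still $\Lambda^*$, the mass is $M-(m_1+\dots+m_k)$, $\Lambda=\Lambda^{(C)}$ is unchanged, and $\phi_1$ has the standard form with constant $C_k$. (For $k=0$, $C_0$ is the constant squared charge of the initial metric.) -/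

import Mathlib

noncomputable section

namespace ChargedDeSitter

/-- Coordinates `x 0 = u`, `x 1 = r`, `x 2 = θ`, `x 3 = φ`. -/
abbrev Coord := Fin 4 → ℝ

/-! ### Tensor calculus in coordinates, for an arbitrary metric `g` -/

/-- The partial derivative `∂f/∂xᵃ`. -/
def pd (a : Fin 4) (f : Coord → ℝ) (x : Coord) : ℝ :=
  deriv (fun t => f (Function.update x a t)) (x a)

/-- The Christoffel symbol `Γᶜ_{ab}` of the Levi-Civita connection. -/
def christoffel (g : Coord → Matrix (Fin 4) (Fin 4) ℝ) (c a b : Fin 4) (x : Coord) : ℝ :=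
  (1 / 2) * ∑ d, (g x)⁻¹ c d *
    (pd a (fun y => g y d b) x + pd b (fun y => g y d a) x - pd d (fun y => g y a b) x)

/-- The Ricci tensor `R_{ab}`, with the sign that is customary in the Newman-Penrose formalism with
signature `(+,-,-,-)`: de Sitter space with cosmological constant `L` has `R_{ab} = L g_{ab}`. -/
def ricci (g : Coord → Matrix (Fin 4) (Fin 4) ℝ) (a b : Fin 4) (x : Coord) : ℝ :=
  ∑ c, (pd b (christoffel g c a c) x - pd c (christoffel g c a b) x) +
  ∑ c, ∑ d, (christoffel g d a c x * christoffel g c b d x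
    - christoffel g d a b x * christoffel g c c d x)

/-- The trace `R_{ab} g^{ab}`. -/
def ricciTrace (g : Coord → Matrix (Fin 4) (Fin 4) ℝ) (x : Coord) : ℝ :=
  ∑ a, ∑ b, ricci g a b x * (g x)⁻¹ a b

/-- The Newman-Penrose Ricci scalar `Λ = R_{ab} g^{ab} / 24`. -/
def ricciScalar (g : Coord → Matrix (Fin 4) (Fin 4) ℝ) (x : Coord) : ℝ :=
  (1 / 24) * ricciTrace g x

/-- Raising the indices of a two-form: `F^{ab} = g^{ac} g^{bd} F_{cd}`. -/
def raise₂ (g : Coord → Matrix (Fin 4) (Fin 4) ℝ) (F : Coord → Matrix (Fin 4) (Fin 4) ℝ)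
    (a b : Fin 4) (x : Coord) : ℝ :=
  ∑ c, ∑ d, (g x)⁻¹ a c * (g x)⁻¹ b d * F x c d

/-- The trace-free energy-momentum tensor `- F_{ac} F_b^c + (1/4) g_{ab} F_{cd} F^{cd}`. -/
def maxwellStress (g : Coord → Matrix (Fin 4) (Fin 4) ℝ) (F : Coord → Matrix (Fin 4) (Fin 4) ℝ)
    (a b : Fin 4) (x : Coord) : ℝ :=
  - ∑ c, ∑ d, F x a c * F x b d * (g x)⁻¹ c d
    + (1 / 4) * g x a b * ∑ c, ∑ d, F x c d * raise₂ g F c d x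

/-- `F` is a source-free Maxwell field on `U`: a continuously differentiable two-form with
`dF = 0` and `∇_a F^{ab} = 0`, the latter written as `∂_a (√|det g| F^{ab}) = 0`. -/
structure IsMaxwellField (g : Coord → Matrix (Fin 4) (Fin 4) ℝ) (U : Set Coord)
    (F : Coord → Matrix (Fin 4) (Fin 4) ℝ) : Prop where
  contDiff : ∀ a b, ContDiffOn ℝ 1 (fun x => F x a b) U
  antisymm : ∀ x ∈ U, ∀ a b, F x a b = - F x b a
  closed : ∀ x ∈ U, ∀ a b c, pd a (fun y => F y b c) x + pd b (fun y => F y c a) x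
    + pd c (fun y => F y a b) x = 0
  coclosed : ∀ x ∈ U, ∀ b,
    ∑ a, pd a (fun y => Real.sqrt |(g y).det| * raise₂ g F a b y) x = 0

/-! ### The two families of metrics -/

/-- Non-rotating, or rotating with rotation parameter `a`. -/
inductive BlackHole where
  | reissnerNordstrom : BlackHole
  | kerrNewman (a : ℝ) : BlackHole

/-- The line element with mass `M`, cosmological constant `L` and squared charge `Q(r) = e²(r)`;
only the square of the charge enters. -/
def metric : BlackHole → (L M : ℝ) → (Q : ℝ → ℝ) → Coord → Matrix (Fin 4) (Fin 4) ℝ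
  | .reissnerNordstrom, L, M, Q, x =>
    let r := x 1
    let s := Real.sin (x 2)
    !![1 - 2 * M / r + Q r / r ^ 2 - L * r ^ 2 / 3, 1, 0, 0;
       1, 0, 0, 0;
       0, 0, - r ^ 2, 0;
       0, 0, 0, - r ^ 2 * s ^ 2]
  | .kerrNewman a, L, M, Q, x =>
    let r := x 1
    let s := Real.sin (x 2)
    let R2 := r ^ 2 + a ^ 2 * Real.cos (x 2) ^ 2
    let H := 2 * M * r - Q r + L * r ^ 4 / 3
    let Δ := r ^ 2 - 2 * M * r + a ^ 2 + Q r - L * r ^ 4 / 3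
    !![1 - H / R2, 1, 0, a * H / R2 * s ^ 2;
       1, 0, 0, - a * s ^ 2;
       0, 0, - R2, 0;
       a * H / R2 * s ^ 2, - a * s ^ 2, 0,
         - ((r ^ 2 + a ^ 2) ^ 2 - Δ * a ^ 2 * s ^ 2) / R2 * s ^ 2]

/-- The part of the coordinate chart over a set `J` of values of `r`. -/
def region (J : Set ℝ) : Set Coord := {x | x 1 ∈ J ∧ x 2 ∈ Set.Ioo 0 Real.pi}

/-- The complex quantity `R`: `r` without rotation, `r + i a cos θ` with rotation. -/
def bigR : BlackHole → Coord → ℂ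
  | .reissnerNordstrom, x => (x 1 : ℂ)
  | .kerrNewman a, x => (x 1 : ℂ) + Complex.I * (a * Real.cos (x 2) : ℝ)

/-- The real quantity `R² = |R|²`: `r²`, respectively `r² + a² cos² θ`. -/
def Rsq : BlackHole → Coord → ℝ
  | .reissnerNordstrom, x => x 1 ^ 2
  | .kerrNewman a, x => x 1 ^ 2 + a ^ 2 * Real.cos (x 2) ^ 2

/-- The covector `ℓ_a` of the null tetrad. -/
def tetradL : BlackHole → Coord → Fin 4 → ℂ
  | .reissnerNordstrom, _ => ![1, 0, 0, 0]
  | .kerrNewman a, x => ![1, 0, 0, ((- a * Real.sin (x 2) ^ 2 : ℝ) : ℂ)]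

/-- The covector `n_a` of the null tetrad. -/
def tetradN : BlackHole → (L M : ℝ) → (Q : ℝ → ℝ) → Coord → Fin 4 → ℂ
  | .reissnerNordstrom, L, M, Q, x =>
    let r := x 1
    ![(((1 - 2 * M / r + Q r / r ^ 2 - L * r ^ 2 / 3) / 2 : ℝ) : ℂ), 1, 0, 0]
  | .kerrNewman a, L, M, Q, x =>
    let r := x 1
    let R2 := r ^ 2 + a ^ 2 * Real.cos (x 2) ^ 2
    let Δ := r ^ 2 - 2 * M * r + a ^ 2 + Q r - L * r ^ 4 / 3
    ![((Δ / (2 * R2) : ℝ) : ℂ), 1, 0, ((- (Δ / (2 * R2)) * a * Real.sin (x 2) ^ 2 : ℝ) : ℂ)]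

/-- The complex covector `m_a` of the null tetrad; its conjugate is the fourth member. -/
def tetradM : BlackHole → Coord → Fin 4 → ℂ
  | .reissnerNordstrom, x =>
    ![0, 0, ((- x 1 / Real.sqrt 2 : ℝ) : ℂ),
      Complex.I * ((- x 1 / Real.sqrt 2 * Real.sin (x 2) : ℝ) : ℂ)]
  | .kerrNewman a, x =>
    let k : ℂ := - 1 / ((Real.sqrt 2 : ℝ) * bigR (.kerrNewman a) x)
    ![k * (- Complex.I * ((a * Real.sin (x 2) : ℝ) : ℂ)), 0,
      k * ((Rsq (.kerrNewman a) x : ℝ) : ℂ),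
      k * (Complex.I * (((x 1 ^ 2 + a ^ 2) * Real.sin (x 2) : ℝ) : ℂ))]

/-- Raising the index of a complex covector with a real metric at a point. -/
def raise (g : Matrix (Fin 4) (Fin 4) ℝ) (v : Fin 4 → ℂ) (a : Fin 4) : ℂ :=
  ∑ b, ((g⁻¹ a b : ℝ) : ℂ) * v b

/-- The Maxwell scalar `φ₁ = (1/2) F_{ab} (ℓᵃ nᵇ + m̄ᵃ mᵇ)`. -/
def maxwellScalar (B : BlackHole) (L M : ℝ) (Q : ℝ → ℝ) (F : Coord → Matrix (Fin 4) (Fin 4) ℝ)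
    (x : Coord) : ℂ :=
  let g := metric B L M Q x
  let l := raise g (tetradL B x)
  let n := raise g (tetradN B L M Q x)
  let m := raise g (tetradM B x)
  let mb := raise g (fun a => star (tetradM B x a))
  (1 / 2) * ∑ a, ∑ b, ((F x a b : ℝ) : ℂ) * (l a * n b + mb a * m b)

/-- The cosmological Ricci scalar `Λ^(C)`. -/
def cosmScalar : BlackHole → ℝ → Coord → ℝ
  | .reissnerNordstrom, L, _ => L / 6
  | .kerrNewman a, L, x => L * x 1 ^ 2 / (6 * Rsq (.kerrNewman a) x)

/-- The electromagnetic Ricci scalar `Λ^(E) = Λ - Λ^(C)` of the metric with mass `M`,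
cosmological constant `L` and squared charge `Q`. -/
def emScalar (B : BlackHole) (L M : ℝ) (Q : ℝ → ℝ) (x : Coord) : ℝ :=
  ricciScalar (metric B L M Q) x - cosmScalar B L x

/-- The energy-momentum tensor of the cosmological matter,
`2 ρ ℓ_(a n_b) + 2 p m_(a m̄_b)` with density `ρ = L r⁴ / R⁴` and pressure
`p = - L r² (2 R² - r²) / R⁴`. Without rotation this is `L g_{ab}`;
with rotation `2 R² - r² = r² + 2 a² cos² θ`. -/
def cosmStress (B : BlackHole) (L M : ℝ) (Q : ℝ → ℝ) (a b : Fin 4) (x : Coord) : ℂ :=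
  let l := tetradL B x
  let n := tetradN B L M Q x
  let m := tetradM B x
  let ρ : ℝ := L * x 1 ^ 4 / Rsq B x ^ 2
  let p : ℝ := - L * x 1 ^ 2 * (2 * Rsq B x - x 1 ^ 2) / Rsq B x ^ 2
  (ρ : ℂ) * (l a * n b + n a * l b) + (p : ℂ) * (m a * star (m b) + star (m a) * m b)

/-- `F` solves, together with the metric, the Einstein-Maxwell equations with cosmological matter
`R_{ab} - (1/2) R g_{ab} = - (T^(E)_{ab} + T^(C)_{ab})` and the source-free Maxwell equations. -/
structure IsEinsteinMaxwell (B : BlackHole) (J : Set ℝ) (L M : ℝ) (Q : ℝ → ℝ)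
    (F : Coord → Matrix (Fin 4) (Fin 4) ℝ) : Prop where
  maxwell : IsMaxwellField (metric B L M Q) (region J) F
  einstein : ∀ x ∈ region J, ∀ a b,
    ((ricci (metric B L M Q) a b x
        - (1 / 2) * ricciTrace (metric B L M Q) x * metric B L M Q x a b : ℝ) : ℂ)
      = - (((maxwellStress (metric B L M Q) F a b x : ℝ) : ℂ) + cosmStress B L M Q a b x)

/-- The Maxwell scalar of the metric has the form `φ₁ = e / (√2 R̄²)` with `e² = C`.
Every electromagnetic field of the metric has this scalar up to a constant phase (the freedom of
duality rotations, which the metric does not see), which also forces `C ≥ 0`; and for each real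
`e` with `e² = C` there is a field of the metric whose scalar is exactly `e / (√2 R̄²)`. -/
def HasMaxwellScalarForm (B : BlackHole) (J : Set ℝ) (L M : ℝ) (Q : ℝ → ℝ) (C : ℝ) : Prop :=
  (∀ F, IsEinsteinMaxwell B J L M Q F →
    0 ≤ C ∧ ∃ ω : ℂ, ‖ω‖ = 1 ∧ ∀ x ∈ region J,
      maxwellScalar B L M Q F x
        = ω * ((Real.sqrt C : ℝ) / ((Real.sqrt 2 : ℝ) * star (bigR B x) ^ 2))) ∧
  (∀ e₀ : ℝ, e₀ ^ 2 = C → ∃ F, IsEinsteinMaxwell B J L M Q F ∧ ∀ x ∈ region J,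
      maxwellScalar B L M Q F x
        = (e₀ : ℂ) / ((Real.sqrt 2 : ℝ) * star (bigR B x) ^ 2))

/-- One electrical radiation: the charge of the black hole of mass `M` is a function `e(r)` with
vanishing `Λ^(E)`, and the resulting metric is the one with cosmological constant `L'`, mass `M'`
and constant squared charge `C'`. -/
structure IsElectricalRadiation (B : BlackHole) (J : Set ℝ) (L M : ℝ) (e : ℝ → ℝ)
    (L' M' C' : ℝ) : Prop where
  contDiff : ContDiffOn ℝ 2 e J
  vanishing : ∀ x ∈ region J, emScalar B L M (fun r => e r ^ 2) x = 0
  becomes : ∀ x ∈ region J,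
    metric B L M (fun r => e r ^ 2) x = metric B L' M' (fun _ => C') x

end ChargedDeSitter

end

noncomputable section

namespace ChargedDeSitter

set_option linter.unusedSimpArgs false
set_option linter.unusedVariables false

/-! ### Partial derivatives -/

/-! Both families are the single Kerr-Schild metric g = g₀ − (H/|R|²) ℓ⊗ℓ, with a = 0 in the
non-rotating case; mass, charge and cosmological constant enter only through H(r) = 2Mr − e²(r) +
Λ*r⁴/3 (`metric_eq_kerrMetric`). Everything is read off from H.

For arbitrary twice differentiable H the Ricci tensor is N(ℓn + nℓ) + S(m m̄ + m̄ m) with S = (H −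
rH')/|R|⁴ and N = S + H''/(2|R|²) (`IsKerrSchild.ricci_eq`). Its trace is H''/|R|², so Λ =
H''/(24|R|²) and Λ^(E) = −(e²)''/(24|R|²). This vanishes exactly when e² is affine; the linear term
2m₁r is then absorbed by the mass term of H. The new parameters are unique because 1, r, r⁴ are
linearly independent on an open set (`isElectricalRadiation_iff`).

For affine e², H − rH' = −(C + Λ*r⁴): the mass drops out and the Einstein equation reduces to T^(E)
= (C/|R|⁴)(ℓn + nℓ + m m̄ + m̄ m). A real two-form with such a stress tensor has no component along
the other bivectors of the tetrad, since T(ℓ,ℓ) = 0 and T(n,n) = 0 are vanishing sums of squares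
(`eq_alignedField_of_stress`). It is described by two functions p, q, for which Maxwell's equations
become d(p + iq) = −2(p + iq) dR/R (`alignedField_maxwell_iff`). Hence (p + iq)R² is a constant α +
iβ on the connected chart, and the stress gives α² + β² = 2C. The phase of α + iβ is the duality
freedom ω. Conversely every α + iβ gives a Maxwell field, which yields existence
(`hasMaxwellScalarForm`).

The tensor computations are made polynomial: cos θ, sin θ, 1/|R|², 1/sin θ and the values of H, H',
H'' are letters c, s, w, t, h, h₁, h₂ subject to s² = 1 − c², w(r² + a²c²) = 1 and ts = 1, and each
component is an identity modulo these relations. The analytic part only has to identify partial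
derivatives with the tabulated expressions. -/

theorem isOpen_region {J : Set ℝ} (hJ : IsOpen J) : IsOpen (region J) :=
  (hJ.preimage (continuous_apply (1 : Fin 4))).inter
    (isOpen_Ioo.preimage (continuous_apply (2 : Fin 4)))

theorem pd_congr {U : Set Coord} (hU : IsOpen U) {f f' : Coord → ℝ}
    (h : ∀ y ∈ U, f y = f' y) {x : Coord} (hx : x ∈ U) (a : Fin 4) : pd a f x = pd a f' x := by
  unfold pd
  apply Filter.EventuallyEq.deriv_eq
  have hc : ContinuousAt (fun t => Function.update x a t) (x a) := by fun_prop
  have : U ∈ nhds (Function.update x a (x a)) := by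
    rw [Function.update_eq_self]; exact hU.mem_nhds hx
  filter_upwards [hc this] with t ht using h _ ht

/-- The partial derivatives of a function of `r` and `θ`. -/
theorem pd_stationary {U : Set Coord} (hU : IsOpen U) {f : Coord → ℝ} {φ : ℝ → ℝ → ℝ}
    (h : ∀ y ∈ U, f y = φ (y 1) (y 2)) {x : Coord} (hx : x ∈ U) {d₁ d₂ : ℝ}
    (h₁ : HasDerivAt (fun t => φ t (x 2)) d₁ (x 1)) (h₂ : HasDerivAt (φ (x 1)) d₂ (x 2))
    (a : Fin 4) : pd a f x = ![0, d₁, d₂, 0] a := by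
  rw [pd_congr hU h hx]
  fin_cases a <;> simp [pd, h₁.deriv, h₂.deriv]

/-- Partial derivatives of a function of `r` and `θ` in the direction `r`. -/
theorem pd_stationary_one {U : Set Coord} (hU : IsOpen U) {f : Coord → ℝ} {φ : ℝ → ℝ → ℝ}
    (h : ∀ y ∈ U, f y = φ (y 1) (y 2)) {x : Coord} (hx : x ∈ U) {d : ℝ}
    (h₁ : HasDerivAt (fun t => φ t (x 2)) d (x 1)) : pd 1 f x = d := by
  rw [pd_congr hU h hx]
  simp [pd, h₁.deriv]

theorem pd_stationary_two {U : Set Coord} (hU : IsOpen U) {f : Coord → ℝ} {φ : ℝ → ℝ → ℝ}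
    (h : ∀ y ∈ U, f y = φ (y 1) (y 2)) {x : Coord} (hx : x ∈ U) {d : ℝ}
    (h₁ : HasDerivAt (φ (x 1)) d (x 2)) : pd 2 f x = d := by
  rw [pd_congr hU h hx]
  simp [pd, h₁.deriv]

theorem pd_stationary_zero {U : Set Coord} (hU : IsOpen U) {f : Coord → ℝ} {φ : ℝ → ℝ → ℝ}
    (h : ∀ y ∈ U, f y = φ (y 1) (y 2)) {x : Coord} (hx : x ∈ U) : pd 0 f x = 0 := by
  rw [pd_congr hU h hx]
  simp [pd]

theorem pd_stationary_three {U : Set Coord} (hU : IsOpen U) {f : Coord → ℝ} {φ : ℝ → ℝ → ℝ}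
    (h : ∀ y ∈ U, f y = φ (y 1) (y 2)) {x : Coord} (hx : x ∈ U) : pd 3 f x = 0 := by
  rw [pd_congr hU h hx]
  simp [pd]

/-! ### The Kerr-Schild metric with an arbitrary function `H(r)`

In the tables `c = cos θ`, `s = sin θ`, `w = 1 / |R|²`, `t = 1 / sin θ`, and `h`, `h₁`, `h₂` are the
values of `H` and of its first two derivatives at `r`. -/

/-- This is g₀ − hw ℓ⊗ℓ with ℓ = du − a s² dφ, where g₀ is the case h = 0. -/
def kerrMetric (a r c s w h : ℝ) : Matrix (Fin 4) (Fin 4) ℝ :=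
  !![1 - h * w, 1, 0, a * (h * w) * s ^ 2;
     1, 0, 0, -a * s ^ 2;
     0, 0, -(r ^ 2 + a ^ 2 * c ^ 2), 0;
     a * (h * w) * s ^ 2, -a * s ^ 2, 0, -((r ^ 2 + a ^ 2) * s ^ 2 + a ^ 2 * s ^ 4 * (h * w))]

/-- The vector dual to ℓ is ∂_r and ℓ is null, so inverting g₀ − hw ℓ⊗ℓ only adds hw ∂_r⊗∂_r to the
inverse of g₀: h occurs in the rr entry alone. -/
def kerrInverse (a r s w t h : ℝ) : Matrix (Fin 4) (Fin 4) ℝ :=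
  !![-(a ^ 2 * s ^ 2 * w), (r ^ 2 + a ^ 2) * w, 0, -(a * w);
     (r ^ 2 + a ^ 2) * w, -((r ^ 2 + a ^ 2 - h) * w), 0, a * w;
     0, 0, -w, 0;
     -(a * w), a * w, 0, -(w * t ^ 2)]

/-- Half the derivative of `H / |R|²` with respect to `r`. -/
def dhr (r w h h₁ : ℝ) : ℝ := w * h₁ / 2 - r * w ^ 2 * h

/-- Half the derivative of `H / |R|²` with respect to `θ`. -/
def dhθ (a c s w h : ℝ) : ℝ := a ^ 2 * c * s * w ^ 2 * h

def kerrMetricDeriv (a r c s w h h₁ : ℝ) : Fin 4 → Matrix (Fin 4) (Fin 4) ℝ :=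
  let q := dhr r w h h₁
  let k := dhθ a c s w h
  ![0,
    !![-2 * q, 0, 0, 2 * a * s ^ 2 * q;
       0, 0, 0, 0;
       0, 0, -2 * r, 0;
       2 * a * s ^ 2 * q, 0, 0, -(2 * r * s ^ 2 + 2 * a ^ 2 * s ^ 4 * q)],
    !![-2 * k, 0, 0, 2 * a * s ^ 2 * k + 2 * a * s * c * (h * w);
       0, 0, 0, -2 * a * s * c;
       0, 0, 2 * a ^ 2 * c * s, 0;
       2 * a * s ^ 2 * k + 2 * a * s * c * (h * w), -2 * a * s * c, 0,
         -(2 * (r ^ 2 + a ^ 2) * s * c + 4 * a ^ 2 * s ^ 3 * c * (h * w) + 2 * a ^ 2 * s ^ 4 * k)],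
    0]

def kerrChristoffel (a r c s w t h h₁ : ℝ) : Fin 4 → Matrix (Fin 4) (Fin 4) ℝ :=
  let q := dhr r w h h₁
  let k := dhθ a c s w h
  let B := r ^ 2 + a ^ 2
  let Δ := r ^ 2 + a ^ 2 - h
  ![!![B * w * q, 0, -k, -(a * s ^ 2 * B * w * q);
       0, 0, a ^ 2 * c * s * w, a * r * s ^ 2 * w;
       -k, a ^ 2 * c * s * w, r * B * w, a * s ^ 2 * k;
       -(a * s ^ 2 * B * w * q), a * r * s ^ 2 * w, a * s ^ 2 * k,
         B * w * s ^ 2 * (a ^ 2 * s ^ 2 * q + r)],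
    !![-(Δ * w * q), -q, 0, a * s ^ 2 * Δ * w * q;
       -q, 0, -(a ^ 2 * c * s * w), a * s ^ 2 * (q - r * w);
       0, -(a ^ 2 * c * s * w), -(r * Δ * w), 0;
       a * s ^ 2 * Δ * w * q, a * s ^ 2 * (q - r * w), 0,
         -(Δ * w * s ^ 2 * (a ^ 2 * s ^ 2 * q + r))],
    !![-(k * w), 0, 0, a * c * s * w ^ 3 * h * B;
       0, 0, r * w, -(a * c * s * w);
       0, r * w, -(a ^ 2 * c * s * w), 0;
       a * c * s * w ^ 3 * h * B, -(a * c * s * w), 0,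
         -(c * s * w * (h * w ^ 2 * B ^ 2 + B - h))],
    !![a * w * q, 0, -(a * c * t * w ^ 2 * h), -(a ^ 2 * s ^ 2 * w * q);
       0, 0, a * c * t * w, r * w;
       -(a * c * t * w ^ 2 * h), a * c * t * w, a * r * w, k + c * t;
       -(a ^ 2 * s ^ 2 * w * q), r * w, k + c * t, a * w * s ^ 2 * (a ^ 2 * s ^ 2 * q + r)]]

/-- The trace `Γᶜ_{ac}`. -/
def kerrChristoffelTrace (a r c s w t : ℝ) : Fin 4 → ℝ :=
  ![0, 2 * r * w, c * t - 2 * a ^ 2 * c * s * w, 0]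

theorem kerrMetric_mul_kerrInverse {a r c s w t h : ℝ} (hs : s ^ 2 = 1 - c ^ 2)
    (hw : w * (r ^ 2 + a ^ 2 * c ^ 2) = 1) (ht : t * s = 1) :
    kerrMetric a r c s w h * kerrInverse a r s w t h = 1 := by
  ext i j
  fin_cases i <;> fin_cases j <;>
    simp [kerrMetric, kerrInverse, Matrix.mul_apply, Fin.sum_univ_four] <;> grind

theorem kerrMetric_inv {a r c s w t h : ℝ} (hs : s ^ 2 = 1 - c ^ 2)
    (hw : w * (r ^ 2 + a ^ 2 * c ^ 2) = 1) (ht : t * s = 1) :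
    (kerrMetric a r c s w h)⁻¹ = kerrInverse a r s w t h :=
  Matrix.inv_eq_right_inv (kerrMetric_mul_kerrInverse hs hw ht)

theorem kerrChristoffel_eq_sum {a r c s w t h h₁ : ℝ} (hs : s ^ 2 = 1 - c ^ 2)
    (hw : w * (r ^ 2 + a ^ 2 * c ^ 2) = 1) (ht : t * s = 1) (i j k : Fin 4) :
    (1 / 2) * ∑ d, kerrInverse a r s w t h i d *
      (kerrMetricDeriv a r c s w h h₁ j d k + kerrMetricDeriv a r c s w h h₁ k d j
        - kerrMetricDeriv a r c s w h h₁ d j k)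
      = kerrChristoffel a r c s w t h h₁ i j k := by
  fin_cases i <;> fin_cases j <;> fin_cases k <;>
    simp only [kerrMetricDeriv, kerrInverse, kerrChristoffel, dhr, dhθ, Fin.sum_univ_four, Fin.isValue, Fin.zero_eta, Fin.mk_one,
      Fin.reduceFinMk, Matrix.of_apply, Matrix.cons_val', Matrix.cons_val, Matrix.zero_apply,
      Matrix.cons_val_fin_one] <;>
    grobner

/-- The trace is the gradient of log √|det g|, and √|det g| = |R|² sin θ does not involve H. -/
theorem kerrChristoffelTrace_eq_sum {a r c s w t h h₁ : ℝ} (hs : s ^ 2 = 1 - c ^ 2)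
    (hw : w * (r ^ 2 + a ^ 2 * c ^ 2) = 1) (ht : t * s = 1) (i : Fin 4) :
    ∑ d, kerrChristoffel a r c s w t h h₁ d i d = kerrChristoffelTrace a r c s w t i := by
  fin_cases i <;>
    simp only [kerrChristoffel, kerrChristoffelTrace, dhr, dhθ, Fin.sum_univ_four, Fin.isValue, Fin.zero_eta, Fin.mk_one,
      Fin.reduceFinMk, Matrix.of_apply, Matrix.cons_val', Matrix.cons_val, Matrix.zero_apply,
      Matrix.cons_val_fin_one] <;>
    grobner

/-! ### The Ricci tensor of the Kerr-Schild metric: algebra -/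

/-- The derivative of `dhr` with respect to `r`. -/
def dhrr (r w h h₁ h₂ : ℝ) : ℝ := w * h₂ / 2 - 2 * r * w ^ 2 * h₁ + (4 * r ^ 2 * w ^ 3 - w ^ 2) * h

/-- The derivative of `cos θ sin θ / |R|²` with respect to `θ`. -/
def dcsw (a c s w : ℝ) : ℝ := (c ^ 2 - s ^ 2) * w + 2 * a ^ 2 * c ^ 2 * s ^ 2 * w ^ 2

/-- The derivatives `∂ᵣ Γʳ_{ab}`. -/
def kerrChristoffelDerivR (a r c s w h h₁ h₂ : ℝ) : Matrix (Fin 4) (Fin 4) ℝ :=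
  let q := dhr r w h h₁
  let q' := dhrr r w h h₁ h₂
  let Δ := r ^ 2 + a ^ 2 - h
  let d := (2 * r - h₁) * w - 2 * r * w ^ 2 * Δ
  !![-(d * q + Δ * w * q'), -q', 0, a * s ^ 2 * (d * q + Δ * w * q');
     -q', 0, 2 * a ^ 2 * c * s * r * w ^ 2, a * s ^ 2 * (q' - w + 2 * r ^ 2 * w ^ 2);
     0, 2 * a ^ 2 * c * s * r * w ^ 2, -(Δ * w + r * d), 0;
     a * s ^ 2 * (d * q + Δ * w * q'), a * s ^ 2 * (q' - w + 2 * r ^ 2 * w ^ 2), 0,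
       -(d * s ^ 2 * (a ^ 2 * s ^ 2 * q + r) + Δ * w * s ^ 2 * (a ^ 2 * s ^ 2 * q' + 1))]

/-- The derivatives `∂_θ Γ^θ_{ab}`. -/
def kerrChristoffelDerivθ (a r c s w h : ℝ) : Matrix (Fin 4) (Fin 4) ℝ :=
  let B := r ^ 2 + a ^ 2
  let f := dcsw a c s w
  let e₀₃ := a * h * B * (f * w ^ 2 + 4 * a ^ 2 * c ^ 2 * s ^ 2 * w ^ 4)
  !![-(a ^ 2 * h * (f * w ^ 2 + 4 * a ^ 2 * c ^ 2 * s ^ 2 * w ^ 4)), 0, 0, e₀₃;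
     0, 0, 2 * a ^ 2 * c * s * r * w ^ 2, -(a * f);
     0, 2 * a ^ 2 * c * s * r * w ^ 2, -(a ^ 2 * f), 0;
     e₀₃, -(a * f), 0,
       -(f * (h * w ^ 2 * B ^ 2 + B - h) + 4 * a ^ 2 * c ^ 2 * s ^ 2 * w ^ 4 * h * B ^ 2)]

/-- The derivatives `∂_b Γᶜ_{ac}`. -/
def kerrChristoffelTraceDeriv (a r c s w t : ℝ) : Matrix (Fin 4) (Fin 4) ℝ :=
  !![0, 0, 0, 0;
     0, 2 * w - 4 * r ^ 2 * w ^ 2, 4 * r * a ^ 2 * c * s * w ^ 2, 0;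
     0, 4 * r * a ^ 2 * c * s * w ^ 2, -(1 + c ^ 2 * t ^ 2) - 2 * a ^ 2 * dcsw a c s w, 0;
     0, 0, 0, 0]

/-- The tensor `ℓ_a n_b + n_a ℓ_b`. -/
def nullPart (a r s w h : ℝ) : Matrix (Fin 4) (Fin 4) ℝ :=
  let δ := (r ^ 2 + a ^ 2 - h) * w
  !![δ, 1, 0, -(a * s ^ 2 * δ);
     1, 0, 0, -(a * s ^ 2);
     0, 0, 0, 0;
     -(a * s ^ 2 * δ), -(a * s ^ 2), 0, a ^ 2 * s ^ 4 * δ]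

/-- The tensor `m_a m̄_b + m̄_a m_b`. -/
def spherePart (a r c s w : ℝ) : Matrix (Fin 4) (Fin 4) ℝ :=
  !![a ^ 2 * s ^ 2 * w, 0, 0, -(a * s ^ 2 * (r ^ 2 + a ^ 2) * w);
     0, 0, 0, 0;
     0, 0, r ^ 2 + a ^ 2 * c ^ 2, 0;
     -(a * s ^ 2 * (r ^ 2 + a ^ 2) * w), 0, 0, s ^ 2 * (r ^ 2 + a ^ 2) ^ 2 * w]

/-- Since g = `nullPart` − `spherePart`, the Ricci tensor has two double eigenvalues relative to g:
`ricciNull` on the plane of ℓ, n and −`ricciSphere` on the plane of m, m̄. -/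
def ricciSphere (r w h h₁ : ℝ) : ℝ := w ^ 2 * (h - r * h₁)

def ricciNull (r w h h₁ h₂ : ℝ) : ℝ := ricciSphere r w h h₁ + w * h₂ / 2

theorem kerrMetric_eq {a r c s w h : ℝ} (hs : s ^ 2 = 1 - c ^ 2)
    (hw : w * (r ^ 2 + a ^ 2 * c ^ 2) = 1) :
    kerrMetric a r c s w h = nullPart a r s w h - spherePart a r c s w := by
  ext i j
  rw [Matrix.sub_apply]
  fin_cases i <;> fin_cases j <;>
    simp only [kerrMetric, nullPart, spherePart, Fin.isValue, Fin.zero_eta, Fin.mk_one,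
      Fin.reduceFinMk, Matrix.of_apply, Matrix.cons_val', Matrix.cons_val, Matrix.zero_apply,
      Matrix.cons_val_fin_one] <;>
    grobner

/-- With the derivatives of the Christoffel symbols tabulated, the Ricci tensor is a polynomial in
the letters. The terms quadratic in h that remain on the right come only from the h inside n; the
two coefficients are linear in h, h₁, h₂. -/
theorem kerrRicci_eq_sum {a r c s w t h h₁ h₂ : ℝ} (hs : s ^ 2 = 1 - c ^ 2)
    (hw : w * (r ^ 2 + a ^ 2 * c ^ 2) = 1) (ht : t * s = 1) (i j : Fin 4) :
    kerrChristoffelTraceDeriv a r c s w t i j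
      - (kerrChristoffelDerivR a r c s w h h₁ h₂ i j + kerrChristoffelDerivθ a r c s w h i j)
      + ((∑ k, ∑ l, kerrChristoffel a r c s w t h h₁ l i k * kerrChristoffel a r c s w t h h₁ k j l)
      - ∑ l, kerrChristoffel a r c s w t h h₁ l i j * kerrChristoffelTrace a r c s w t l)
      = ricciNull r w h h₁ h₂ * nullPart a r s w h i j
        + ricciSphere r w h h₁ * spherePart a r c s w i j := by
  fin_cases i <;> fin_cases j <;>
    simp only [kerrChristoffelTraceDeriv, kerrChristoffelDerivR, kerrChristoffelDerivθ, dhr, dhθ,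
      dhrr, dcsw, kerrChristoffel, kerrChristoffelTrace, ricciNull, ricciSphere, nullPart,
      spherePart, Fin.sum_univ_four, Fin.isValue, Fin.zero_eta, Fin.mk_one,
      Fin.reduceFinMk, Matrix.of_apply, Matrix.cons_val', Matrix.cons_val, Matrix.zero_apply,
      Matrix.cons_val_fin_one, mul_zero, zero_mul, add_zero, zero_add] <;>
    grobner

theorem nullPart_trace {a r c s w t h : ℝ} (hs : s ^ 2 = 1 - c ^ 2)
    (hw : w * (r ^ 2 + a ^ 2 * c ^ 2) = 1) (ht : t * s = 1) :
    ∑ i, ∑ j, nullPart a r s w h i j * kerrInverse a r s w t h i j = 2 := by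
  simp only [nullPart, kerrInverse, Fin.sum_univ_four, Fin.isValue, Matrix.of_apply,
    Matrix.cons_val', Matrix.cons_val, Matrix.cons_val_fin_one]
  grobner

theorem spherePart_trace {a r c s w t h : ℝ} (hs : s ^ 2 = 1 - c ^ 2)
    (hw : w * (r ^ 2 + a ^ 2 * c ^ 2) = 1) (ht : t * s = 1) :
    ∑ i, ∑ j, spherePart a r c s w i j * kerrInverse a r s w t h i j = -2 := by
  simp only [spherePart, kerrInverse, Fin.sum_univ_four, Fin.isValue, Matrix.of_apply,
    Matrix.cons_val', Matrix.cons_val, Matrix.cons_val_fin_one]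
  grobner

/-! ### The Ricci tensor of the Kerr-Schild metric: analysis -/

/-- `1 / |R|²`. -/
def invRsq (a r θ : ℝ) : ℝ := (r ^ 2 + a ^ 2 * Real.cos θ ^ 2)⁻¹

theorem invRsq_mul (a : ℝ) {r : ℝ} (hr : r ≠ 0) (θ : ℝ) :
    invRsq a r θ * (r ^ 2 + a ^ 2 * Real.cos θ ^ 2) = 1 := by
  unfold invRsq
  have : 0 < r ^ 2 + a ^ 2 * Real.cos θ ^ 2 := by positivity
  field_simp

theorem hasDerivAt_invRsq_r (a : ℝ) {r : ℝ} (hr : r ≠ 0) (θ : ℝ) :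
    HasDerivAt (fun t => invRsq a t θ) (-2 * r * invRsq a r θ ^ 2) r := by
  have h0 : r ^ 2 + a ^ 2 * Real.cos θ ^ 2 ≠ 0 := by positivity
  have h := (((hasDerivAt_id' r).fun_pow 2).add_const (a ^ 2 * Real.cos θ ^ 2)).fun_inv h0
  refine h.congr_deriv ?_
  unfold invRsq
  field_simp
  norm_num [mul_comm]

theorem hasDerivAt_invRsq_θ (a : ℝ) {r : ℝ} (hr : r ≠ 0) (θ : ℝ) :
    HasDerivAt (invRsq a r)
      (2 * a ^ 2 * Real.cos θ * Real.sin θ * invRsq a r θ ^ 2) θ := by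
  have h0 : r ^ 2 + a ^ 2 * Real.cos θ ^ 2 ≠ 0 := by positivity
  have h := ((((Real.hasDerivAt_cos θ).fun_pow 2).const_mul (a ^ 2)).const_add (r ^ 2)).fun_inv h0
  refine h.congr_deriv ?_
  unfold invRsq
  field_simp
  norm_num
  ring

/-- The metric `g` is the Kerr-Schild metric with function `H` on the chart over `J`, where `H₁` and
`H₂` are the first two derivatives of `H`. -/
structure IsKerrSchild (a : ℝ) (J : Set ℝ) (H H₁ H₂ : ℝ → ℝ)
    (g : Coord → Matrix (Fin 4) (Fin 4) ℝ) : Prop where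
  isOpen : IsOpen J
  zero_notMem : (0 : ℝ) ∉ J
  hasDerivAt : ∀ r ∈ J, HasDerivAt H (H₁ r) r
  hasDerivAt_deriv : ∀ r ∈ J, HasDerivAt H₁ (H₂ r) r
  eq : ∀ x ∈ region J, g x =
    kerrMetric a (x 1) (Real.cos (x 2)) (Real.sin (x 2)) (invRsq a (x 1) (x 2)) (H (x 1))

/-- About w only the equation ∂_r w = −2r w² at the point is used. Derivatives of table entries are
thus again polynomials in the letters, and the comparison is a ring identity. -/
theorem hasDerivAt_kerrMetric_r {a r c s : ℝ} {w h : ℝ → ℝ} {h₁ : ℝ}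
    (hw : HasDerivAt w (-2 * r * w r ^ 2) r) (hh : HasDerivAt h h₁ r) (i j : Fin 4) :
    HasDerivAt (fun t => kerrMetric a t c s (w t) (h t) i j)
      (kerrMetricDeriv a r c s (w r) (h r) h₁ 1 i j) r := by
  fin_cases i <;> fin_cases j <;>
    simp only [kerrMetricDeriv, kerrMetric, dhr, dhθ, Fin.isValue, Fin.zero_eta, Fin.mk_one,
      Fin.reduceFinMk, Matrix.of_apply, Matrix.cons_val', Matrix.cons_val,
      Matrix.cons_val_fin_one] <;>
    (apply HasDerivAt.congr_deriv
     · repeat' first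
        | exact hasDerivAt_const _ _ | exact hasDerivAt_id' _ | exact hw | exact hh
        | apply HasDerivAt.fun_add | apply HasDerivAt.fun_sub | apply HasDerivAt.fun_neg
        | apply HasDerivAt.fun_pow | apply HasDerivAt.fun_mul
     · try simp only [Nat.cast_ofNat, Nat.add_one_sub_one, Nat.reduceSub, pow_one]
       try ring)

theorem hasDerivAt_kerrMetric_θ {a r h θ : ℝ} {w : ℝ → ℝ}
    (hw : HasDerivAt w (2 * a ^ 2 * Real.cos θ * Real.sin θ * w θ ^ 2) θ) (h₁ : ℝ) (i j : Fin 4) :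
    HasDerivAt (fun t => kerrMetric a r (Real.cos t) (Real.sin t) (w t) h i j)
      (kerrMetricDeriv a r (Real.cos θ) (Real.sin θ) (w θ) h h₁ 2 i j) θ := by
  fin_cases i <;> fin_cases j <;>
    simp only [kerrMetricDeriv, kerrMetric, dhr, dhθ, Fin.isValue, Fin.zero_eta, Fin.mk_one,
      Fin.reduceFinMk, Matrix.of_apply, Matrix.cons_val', Matrix.cons_val,
      Matrix.cons_val_fin_one] <;>
    (apply HasDerivAt.congr_deriv
     · repeat' first
        | exact hasDerivAt_const _ _ | exact hasDerivAt_id' _ | exact hw | exact Real.hasDerivAt_cos _ | exact Real.hasDerivAt_sin _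
        | apply HasDerivAt.fun_add | apply HasDerivAt.fun_sub | apply HasDerivAt.fun_neg
        | apply HasDerivAt.fun_pow | apply HasDerivAt.fun_mul
     · try simp only [Nat.cast_ofNat, Nat.add_one_sub_one, Nat.reduceSub, pow_one]
       try ring)

theorem hasDerivAt_kerrChristoffel_r {a r c s t : ℝ} {w h h₁ : ℝ → ℝ} {h₂ : ℝ}
    (hw : HasDerivAt w (-2 * r * w r ^ 2) r) (hh : HasDerivAt h (h₁ r) r)
    (hh₁ : HasDerivAt h₁ h₂ r) (i j : Fin 4) :
    HasDerivAt (fun r => kerrChristoffel a r c s (w r) t (h r) (h₁ r) 1 i j)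
      (kerrChristoffelDerivR a r c s (w r) (h r) (h₁ r) h₂ i j) r := by
  fin_cases i <;> fin_cases j <;>
    simp only [kerrChristoffelDerivR, kerrChristoffel, dhr, dhrr, dhθ, Fin.isValue, Fin.zero_eta, Fin.mk_one,
      Fin.reduceFinMk, Matrix.of_apply, Matrix.cons_val', Matrix.cons_val,
      Matrix.cons_val_fin_one] <;>
    (apply HasDerivAt.congr_deriv
     · repeat' first
        | exact hasDerivAt_const _ _ | exact hasDerivAt_id' _ | exact hw | exact hh | exact hh₁
        | apply HasDerivAt.fun_add | apply HasDerivAt.fun_sub | apply HasDerivAt.fun_neg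
        | apply HasDerivAt.fun_pow | apply HasDerivAt.fun_mul
     · try simp only [Nat.cast_ofNat, Nat.add_one_sub_one, Nat.reduceSub, pow_one]
       try ring)

theorem hasDerivAt_kerrChristoffel_θ {a r h h₁ θ : ℝ} {w t : ℝ → ℝ}
    (hw : HasDerivAt w (2 * a ^ 2 * Real.cos θ * Real.sin θ * w θ ^ 2) θ) (i j : Fin 4) :
    HasDerivAt (fun θ => kerrChristoffel a r (Real.cos θ) (Real.sin θ) (w θ) (t θ) h h₁ 2 i j)
      (kerrChristoffelDerivθ a r (Real.cos θ) (Real.sin θ) (w θ) h i j) θ := by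
  fin_cases i <;> fin_cases j <;>
    simp only [kerrChristoffelDerivθ, kerrChristoffel, dhr, dhθ, dcsw, Fin.isValue, Fin.zero_eta, Fin.mk_one,
      Fin.reduceFinMk, Matrix.of_apply, Matrix.cons_val', Matrix.cons_val,
      Matrix.cons_val_fin_one] <;>
    (apply HasDerivAt.congr_deriv
     · repeat' first
        | exact hasDerivAt_const _ _ | exact hasDerivAt_id' _ | exact hw | exact Real.hasDerivAt_cos _ | exact Real.hasDerivAt_sin _
        | apply HasDerivAt.fun_add | apply HasDerivAt.fun_sub | apply HasDerivAt.fun_neg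
        | apply HasDerivAt.fun_pow | apply HasDerivAt.fun_mul
     · try simp only [Nat.cast_ofNat, Nat.add_one_sub_one, Nat.reduceSub, pow_one]
       try ring)

theorem hasDerivAt_kerrChristoffelTrace_r {a r c s t : ℝ} {w : ℝ → ℝ}
    (hw : HasDerivAt w (-2 * r * w r ^ 2) r) (i : Fin 4) :
    HasDerivAt (fun r => kerrChristoffelTrace a r c s (w r) t i)
      (kerrChristoffelTraceDeriv a r c s (w r) t i 1) r := by
  fin_cases i <;>
    simp only [kerrChristoffelTraceDeriv, kerrChristoffelTrace, Fin.isValue, Fin.zero_eta, Fin.mk_one,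
      Fin.reduceFinMk, Matrix.of_apply, Matrix.cons_val', Matrix.cons_val,
      Matrix.cons_val_fin_one] <;>
    (apply HasDerivAt.congr_deriv
     · repeat' first
        | exact hasDerivAt_const _ _ | exact hasDerivAt_id' _ | exact hw
        | apply HasDerivAt.fun_add | apply HasDerivAt.fun_sub | apply HasDerivAt.fun_neg
        | apply HasDerivAt.fun_pow | apply HasDerivAt.fun_mul
     · try simp only [Nat.cast_ofNat, Nat.add_one_sub_one, Nat.reduceSub, pow_one]
       try ring)

theorem hasDerivAt_kerrChristoffelTrace_θ {a r θ : ℝ} {w t : ℝ → ℝ}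
    (hw : HasDerivAt w (2 * a ^ 2 * Real.cos θ * Real.sin θ * w θ ^ 2) θ)
    (ht : HasDerivAt t (-Real.cos θ * t θ ^ 2) θ) (ht' : t θ * Real.sin θ = 1) (i : Fin 4) :
    HasDerivAt (fun θ => kerrChristoffelTrace a r (Real.cos θ) (Real.sin θ) (w θ) (t θ) i)
      (kerrChristoffelTraceDeriv a r (Real.cos θ) (Real.sin θ) (w θ) (t θ) i 2) θ := by
  fin_cases i <;>
    simp only [kerrChristoffelTraceDeriv, kerrChristoffelTrace, dcsw, Fin.isValue, Fin.zero_eta, Fin.mk_one,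
      Fin.reduceFinMk, Matrix.of_apply, Matrix.cons_val', Matrix.cons_val,
      Matrix.cons_val_fin_one] <;>
    (apply HasDerivAt.congr_deriv
     · repeat' first
        | exact hasDerivAt_const _ _ | exact hasDerivAt_id' _ | exact hw | exact ht | exact Real.hasDerivAt_cos _ | exact Real.hasDerivAt_sin _
        | apply HasDerivAt.fun_add | apply HasDerivAt.fun_sub | apply HasDerivAt.fun_neg
        | apply HasDerivAt.fun_pow | apply HasDerivAt.fun_mul
     · try simp only [Nat.cast_ofNat, Nat.add_one_sub_one, Nat.reduceSub, pow_one]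
       -- The θ-derivative of c t is −s t − c² t², which equals −(1 + c² t²) only through t s = 1.
       try grobner)

/-! ### Tools for passing from the tables to functions on the chart -/

theorem sin_pos_of_mem_region {J : Set ℝ} {x : Coord} (hx : x ∈ region J) :
    0 < Real.sin (x 2) :=
  Real.sin_pos_of_mem_Ioo hx.2

theorem sin_sq_eq (θ : ℝ) : Real.sin θ ^ 2 = 1 - Real.cos θ ^ 2 := by
  linarith [Real.sin_sq_add_cos_sq θ]

theorem hasDerivAt_inv_sin {θ : ℝ} (h : Real.sin θ ≠ 0) :
    HasDerivAt (fun θ => (Real.sin θ)⁻¹) (-Real.cos θ * (Real.sin θ)⁻¹ ^ 2) θ := by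
  refine ((Real.hasDerivAt_sin θ).fun_inv h).congr_deriv ?_
  field_simp

/-- Supplies the differentiability of the individual symbols Γᶜ_{ac} needed to exchange derivative
and sum in the trace; their derivatives themselves are never computed. -/
theorem differentiableAt_line {U : Set Coord} (hU : IsOpen U) {f : Coord → ℝ} {φ : ℝ → ℝ → ℝ}
    (h : ∀ y ∈ U, f y = φ (y 1) (y 2)) {x : Coord} (hx : x ∈ U)
    (h₁ : DifferentiableAt ℝ (fun t => φ t (x 2)) (x 1))
    (h₂ : DifferentiableAt ℝ (φ (x 1)) (x 2)) (a : Fin 4) :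
    DifferentiableAt ℝ (fun t => f (Function.update x a t)) (x a) := by
  have hc : ContinuousAt (fun t => Function.update x a t) (x a) := by fun_prop
  have hmem : U ∈ nhds (Function.update x a (x a)) := by
    rw [Function.update_eq_self]; exact hU.mem_nhds hx
  have he : (fun t => f (Function.update x a t)) =ᶠ[nhds (x a)]
      fun t => φ (Function.update x a t 1) (Function.update x a t 2) := by
    filter_upwards [hc hmem] with t ht using h _ ht
  refine DifferentiableAt.congr_of_eventuallyEq ?_ he
  fin_cases a <;> simp <;> assumption

theorem pd_sum {ι : Type*} (s : Finset ι) (f : ι → Coord → ℝ) (x : Coord) (a : Fin 4)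
    (h : ∀ i ∈ s, DifferentiableAt ℝ (fun t => f i (Function.update x a t)) (x a)) :
    ∑ i ∈ s, pd a (f i) x = pd a (fun y => ∑ i ∈ s, f i y) x := by
  unfold pd
  rw [deriv_fun_sum h]

theorem kerrChristoffel_symm {a r c s w t h h₁ : ℝ} (i j k : Fin 4) :
    kerrChristoffel a r c s w t h h₁ i j k = kerrChristoffel a r c s w t h h₁ i k j := by
  fin_cases i <;> fin_cases j <;> fin_cases k <;> rfl

theorem differentiableAt_kerrChristoffel_r {a r c s t : ℝ} {w h h₁ : ℝ → ℝ}
    (hw : DifferentiableAt ℝ w r) (hh : DifferentiableAt ℝ h r) (hh₁ : DifferentiableAt ℝ h₁ r)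
    (i j : Fin 4) :
    DifferentiableAt ℝ (fun r => kerrChristoffel a r c s (w r) t (h r) (h₁ r) i j i) r := by
  fin_cases i <;> fin_cases j <;>
    simp only [kerrChristoffel, dhr, dhθ, Fin.isValue, Fin.zero_eta, Fin.mk_one,
      Fin.reduceFinMk, Matrix.of_apply, Matrix.cons_val', Matrix.cons_val,
      Matrix.cons_val_fin_one] <;>
    fun_prop

theorem differentiableAt_kerrChristoffel_θ {a r h h₁ θ : ℝ} {w t : ℝ → ℝ}
    (hw : DifferentiableAt ℝ w θ) (ht : DifferentiableAt ℝ t θ) (i j : Fin 4) :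
    DifferentiableAt ℝ
      (fun θ => kerrChristoffel a r (Real.cos θ) (Real.sin θ) (w θ) (t θ) h h₁ i j i) θ := by
  fin_cases i <;> fin_cases j <;>
    simp only [kerrChristoffel, dhr, dhθ, Fin.isValue, Fin.zero_eta, Fin.mk_one,
      Fin.reduceFinMk, Matrix.of_apply, Matrix.cons_val', Matrix.cons_val,
      Matrix.cons_val_fin_one] <;>
    fun_prop

/-! ### The Ricci tensor of a Kerr-Schild metric on the chart -/

namespace IsKerrSchild

variable {a : ℝ} {J : Set ℝ} {H H₁ H₂ : ℝ → ℝ} {g : Coord → Matrix (Fin 4) (Fin 4) ℝ}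
  {x : Coord}

theorem ne_zero (hg : IsKerrSchild a J H H₁ H₂ g) (hx : x ∈ region J) : x 1 ≠ 0 :=
  fun h => hg.zero_notMem (h ▸ hx.1)

theorem invRsq_mul (hg : IsKerrSchild a J H H₁ H₂ g) (hx : x ∈ region J) :
    invRsq a (x 1) (x 2) * (x 1 ^ 2 + a ^ 2 * Real.cos (x 2) ^ 2) = 1 :=
  ChargedDeSitter.invRsq_mul a (hg.ne_zero hx) _

theorem inv (hg : IsKerrSchild a J H H₁ H₂ g) (hx : x ∈ region J) :
    (g x)⁻¹ = kerrInverse a (x 1) (Real.sin (x 2)) (invRsq a (x 1) (x 2))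
      (Real.sin (x 2))⁻¹ (H (x 1)) := by
  rw [hg.eq x hx]
  exact kerrMetric_inv (sin_sq_eq _) (hg.invRsq_mul hx)
    (inv_mul_cancel₀ (sin_pos_of_mem_region hx).ne')

theorem pd_metric (hg : IsKerrSchild a J H H₁ H₂ g) (hx : x ∈ region J) (i j k : Fin 4) :
    pd i (fun y => g y j k) x = kerrMetricDeriv a (x 1) (Real.cos (x 2)) (Real.sin (x 2))
      (invRsq a (x 1) (x 2)) (H (x 1)) (H₁ (x 1)) i j k := by
  have h := pd_stationary (f := fun y => g y j k)
    (φ := fun r θ => kerrMetric a r (Real.cos θ) (Real.sin θ) (invRsq a r θ) (H r) j k)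
    (isOpen_region hg.isOpen) (fun y hy => by rw [hg.eq y hy]) hx
    (hasDerivAt_kerrMetric_r (hasDerivAt_invRsq_r a (hg.ne_zero hx) _)
      (hg.hasDerivAt _ hx.1) j k)
    (hasDerivAt_kerrMetric_θ (hasDerivAt_invRsq_θ a (hg.ne_zero hx) _) (H₁ (x 1)) j k) i
  rw [h]
  fin_cases i <;> rfl

theorem christoffel_eq (hg : IsKerrSchild a J H H₁ H₂ g) (hx : x ∈ region J) (i j k : Fin 4) :
    christoffel g i j k x = kerrChristoffel a (x 1) (Real.cos (x 2)) (Real.sin (x 2))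
      (invRsq a (x 1) (x 2)) (Real.sin (x 2))⁻¹ (H (x 1)) (H₁ (x 1)) i j k := by
  unfold christoffel
  simp only [hg.pd_metric hx, hg.inv hx]
  exact kerrChristoffel_eq_sum (sin_sq_eq _) (hg.invRsq_mul hx)
    (inv_mul_cancel₀ (sin_pos_of_mem_region hx).ne') i j k

/-- Nothing depends on u or φ, so the divergence reduces to ∂_r Γʳ + ∂_θ Γ^θ; these are the only
upper indices for which derivative tables are needed. -/
theorem pd_christoffel (hg : IsKerrSchild a J H H₁ H₂ g) (hx : x ∈ region J) (i j : Fin 4) :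
    ∑ c, pd c (christoffel g c i j) x =
      kerrChristoffelDerivR a (x 1) (Real.cos (x 2)) (Real.sin (x 2))
        (invRsq a (x 1) (x 2)) (H (x 1)) (H₁ (x 1)) (H₂ (x 1)) i j
      + kerrChristoffelDerivθ a (x 1) (Real.cos (x 2)) (Real.sin (x 2))
        (invRsq a (x 1) (x 2)) (H (x 1)) i j := by
  have hU := isOpen_region hg.isOpen
  let K : Fin 4 → ℝ → ℝ → ℝ := fun c r θ =>
    kerrChristoffel a r (Real.cos θ) (Real.sin θ) (invRsq a r θ) (Real.sin θ)⁻¹ (H r) (H₁ r) c i j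
  have hφ : ∀ c, ∀ y ∈ region J, christoffel g c i j y = K c (y 1) (y 2) :=
    fun c y hy => hg.christoffel_eq hy c i j
  rw [Fin.sum_univ_four, pd_stationary_zero hU (hφ 0) hx, pd_stationary_three hU (hφ 3) hx,
    pd_stationary_one hU (hφ 1) hx (hasDerivAt_kerrChristoffel_r
      (hasDerivAt_invRsq_r a (hg.ne_zero hx) _) (hg.hasDerivAt _ hx.1)
      (hg.hasDerivAt_deriv _ hx.1) i j),
    pd_stationary_two hU (hφ 2) hx (hasDerivAt_kerrChristoffel_θ
      (hasDerivAt_invRsq_θ a (hg.ne_zero hx) _) i j)]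
  ring

theorem sum_pd_christoffel (hg : IsKerrSchild a J H H₁ H₂ g) (hx : x ∈ region J) (i j : Fin 4) :
    ∑ c, pd j (christoffel g c i c) x =
      kerrChristoffelTraceDeriv a (x 1) (Real.cos (x 2)) (Real.sin (x 2))
        (invRsq a (x 1) (x 2)) (Real.sin (x 2))⁻¹ i j := by
  have hU := isOpen_region hg.isOpen
  have hsin := (sin_pos_of_mem_region hx).ne'
  have hr := hg.ne_zero hx
  rw [pd_sum, pd_stationary (f := fun y => ∑ c, christoffel g c i c y)
    (φ := fun r θ => kerrChristoffelTrace a r (Real.cos θ) (Real.sin θ) (invRsq a r θ)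
      (Real.sin θ)⁻¹ i) hU (fun y hy => ?_) hx
    (hasDerivAt_kerrChristoffelTrace_r (hasDerivAt_invRsq_r a hr _) i)
    (hasDerivAt_kerrChristoffelTrace_θ (hasDerivAt_invRsq_θ a hr _)
      (hasDerivAt_inv_sin hsin) (inv_mul_cancel₀ hsin) i)]
  · fin_cases i <;> fin_cases j <;> rfl
  · simp only [hg.christoffel_eq hy]
    exact kerrChristoffelTrace_eq_sum (sin_sq_eq _) (hg.invRsq_mul hy)
      (inv_mul_cancel₀ (sin_pos_of_mem_region hy).ne') i
  · intro c _
    exact differentiableAt_line (φ := fun r θ => kerrChristoffel a r (Real.cos θ) (Real.sin θ)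
        (invRsq a r θ) (Real.sin θ)⁻¹ (H r) (H₁ r) c i c) hU
      (fun y hy => hg.christoffel_eq hy c i c) hx
      (differentiableAt_kerrChristoffel_r (hasDerivAt_invRsq_r a hr _).differentiableAt
        (hg.hasDerivAt _ hx.1).differentiableAt (hg.hasDerivAt_deriv _ hx.1).differentiableAt c i)
      (differentiableAt_kerrChristoffel_θ (hasDerivAt_invRsq_θ a hr _).differentiableAt
        (hasDerivAt_inv_sin hsin).differentiableAt c i) j

theorem ricci_eq (hg : IsKerrSchild a J H H₁ H₂ g) (hx : x ∈ region J) (i j : Fin 4) :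
    ricci g i j x =
      ricciNull (x 1) (invRsq a (x 1) (x 2)) (H (x 1)) (H₁ (x 1)) (H₂ (x 1))
        * nullPart a (x 1) (Real.sin (x 2)) (invRsq a (x 1) (x 2)) (H (x 1)) i j
      + ricciSphere (x 1) (invRsq a (x 1) (x 2)) (H (x 1)) (H₁ (x 1))
        * spherePart a (x 1) (Real.cos (x 2)) (Real.sin (x 2)) (invRsq a (x 1) (x 2)) i j := by
  unfold ricci
  rw [Finset.sum_sub_distrib, hg.sum_pd_christoffel hx, hg.pd_christoffel hx,
    ← kerrRicci_eq_sum (sin_sq_eq _) (hg.invRsq_mul hx)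
      (inv_mul_cancel₀ (sin_pos_of_mem_region hx).ne') i j]
  simp only [hg.christoffel_eq hx, Finset.sum_sub_distrib, ← Finset.mul_sum]
  congr 2
  -- After the exchange the inner sum runs over the contracted index, so it is the trace of the
  -- symbol, up to symmetry in the lower indices.
  rw [Finset.sum_comm]
  refine Finset.sum_congr rfl fun l _ => ?_
  simp only [kerrChristoffel_symm _ _ l]
  rw [← Finset.mul_sum, kerrChristoffelTrace_eq_sum (sin_sq_eq _) (hg.invRsq_mul hx)
      (inv_mul_cancel₀ (sin_pos_of_mem_region hx).ne')]

/-- The null part has trace 2 and the spherical part trace −2, so only `ricciNull` − `ricciSphere` =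
w H''/2 survives. -/
theorem ricciTrace_eq (hg : IsKerrSchild a J H H₁ H₂ g) (hx : x ∈ region J) :
    ricciTrace g x = H₂ (x 1) * invRsq a (x 1) (x 2) := by
  have hs := sin_sq_eq (x 2)
  have hw := hg.invRsq_mul hx
  have ht := inv_mul_cancel₀ (sin_pos_of_mem_region hx).ne'
  simp only [ricciTrace, hg.ricci_eq hx, hg.inv hx, add_mul, mul_assoc, Finset.sum_add_distrib,
    ← Finset.mul_sum]
  rw [nullPart_trace hs hw ht, spherePart_trace hs hw ht]
  unfold ricciNull
  ring

end IsKerrSchild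

/-! ### Aligned electromagnetic fields: algebra -/

/-- The two-form `p ℓ ∧ n + q sin θ dθ ∧ (-a du + (r² + a²) dφ)`. -/
def alignedField (a r s p q : ℝ) : Matrix (Fin 4) (Fin 4) ℝ :=
  !![0, p, a * s * q, 0;
     -p, 0, 0, a * s ^ 2 * p;
     -(a * s * q), 0, 0, s * (r ^ 2 + a ^ 2) * q;
     0, -(a * s ^ 2 * p), -(s * (r ^ 2 + a ^ 2) * q), 0]

/-- The density `√|det g| F^{ab}` of an aligned field. -/
def alignedDensity (a r s p q : ℝ) : Matrix (Fin 4) (Fin 4) ℝ :=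
  !![0, -(s * (r ^ 2 + a ^ 2) * p), -(a * s ^ 2 * q), 0;
     s * (r ^ 2 + a ^ 2) * p, 0, 0, a * s * p;
     a * s ^ 2 * q, 0, 0, q;
     0, -(a * s * p), -q, 0]

theorem alignedField_antisymm (a r s p q : ℝ) (i j : Fin 4) :
    alignedField a r s p q i j = -alignedField a r s p q j i := by
  fin_cases i <;> fin_cases j <;> simp [alignedField]

/-- Changing H changes n by a multiple of ℓ, so ℓ∧n and its dual do not see H; this is why
`alignedDensity` is free of h. The factor w t is the reciprocal of √|det g|. -/
theorem raise_alignedField {a r c s w t h p q : ℝ} (hs : s ^ 2 = 1 - c ^ 2)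
    (hw : w * (r ^ 2 + a ^ 2 * c ^ 2) = 1) (ht : t * s = 1) (i j : Fin 4) :
    ∑ k, ∑ l, kerrInverse a r s w t h i k * kerrInverse a r s w t h j l
      * alignedField a r s p q k l = w * t * alignedDensity a r s p q i j := by
  fin_cases i <;> fin_cases j <;>
    simp only [alignedField, alignedDensity, kerrInverse, Fin.sum_univ_four, Fin.isValue,
      Fin.zero_eta, Fin.mk_one, Fin.reduceFinMk, Matrix.of_apply, Matrix.cons_val',
      Matrix.cons_val, Matrix.cons_val_fin_one, mul_zero, zero_mul, add_zero, zero_add] <;>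
    grobner

theorem alignedField_invariant {a r c s w t p q : ℝ} (hs : s ^ 2 = 1 - c ^ 2)
    (hw : w * (r ^ 2 + a ^ 2 * c ^ 2) = 1) (ht : t * s = 1) :
    ∑ i, ∑ j, alignedField a r s p q i j * (w * t * alignedDensity a r s p q i j)
      = 2 * (q ^ 2 - p ^ 2) := by
  simp only [alignedField, alignedDensity, Fin.sum_univ_four, Fin.isValue,
      Matrix.of_apply, Matrix.cons_val', Matrix.cons_val, Matrix.cons_val_fin_one]
  grobner

/-- Only the duality invariant p² + q² enters, so the metric cannot determine the phase of p + iq.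
-/
theorem alignedField_stress {a r c s w t h p q : ℝ} (hs : s ^ 2 = 1 - c ^ 2)
    (hw : w * (r ^ 2 + a ^ 2 * c ^ 2) = 1) (ht : t * s = 1) (i j : Fin 4) :
    -∑ k, ∑ l, alignedField a r s p q i k * alignedField a r s p q j l
        * kerrInverse a r s w t h k l
      + (1 / 4) * kerrMetric a r c s w h i j * (2 * (q ^ 2 - p ^ 2))
      = (p ^ 2 + q ^ 2) / 2 * (nullPart a r s w h i j + spherePart a r c s w i j) := by
  fin_cases i <;> fin_cases j <;>
    simp only [alignedField, kerrMetric, kerrInverse, nullPart, spherePart, Fin.sum_univ_four,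
      Fin.isValue, Fin.zero_eta, Fin.mk_one, Fin.reduceFinMk, Matrix.of_apply, Matrix.cons_val',
      Matrix.cons_val, Matrix.cons_val_fin_one, mul_zero, zero_mul, add_zero, zero_add] <;>
    grobner

/-- A stress tensor proportional to `ℓ_(a n_b) + m_(a m̄_b)` comes from an aligned field. -/
theorem eq_alignedField_of_stress {a r c s w t h : ℝ} (hs : s ^ 2 = 1 - c ^ 2)
    (hw : w * (r ^ 2 + a ^ 2 * c ^ 2) = 1) (ht : t * s = 1) (hr : r ≠ 0)
    {F : Matrix (Fin 4) (Fin 4) ℝ} (hF : ∀ i j, F i j = -F j i) {I κ : ℝ}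
    (hT : ∀ i j, -∑ k, ∑ l, F i k * F j l * kerrInverse a r s w t h k l
      + (1 / 4) * kerrMetric a r c s w h i j * I
      = κ * (nullPart a r s w h i j + spherePart a r c s w i j)) :
    F = alignedField a r s (F 0 1) (F 2 3 / (s * (r ^ 2 + a ^ 2))) := by
  have hs0 : s ≠ 0 := right_ne_zero_of_mul_eq_one ht
  have hB : r ^ 2 + a ^ 2 ≠ 0 := by positivity
  have hw0 : 0 < w := by
    have : 0 < r ^ 2 + a ^ 2 * c ^ 2 := by positivity
    exact pos_of_mul_pos_left (hw ▸ one_pos) this.le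
  have d0 : F 0 0 = 0 := by linarith [hF 0 0]
  have d1 : F 1 1 = 0 := by linarith [hF 1 1]
  have d2 : F 2 2 = 0 := by linarith [hF 2 2]
  have d3 : F 3 3 = 0 := by linarith [hF 3 3]
  have e10 := hF 1 0
  have e20 := hF 2 0
  have e30 := hF 3 0
  have e21 := hF 2 1
  have e31 := hF 3 1
  have e32 := hF 3 2
  have h11 := hT 1 1
  have h00 := hT 0 0
  have h01 := hT 0 1
  have h03 := hT 0 3
  have h13 := hT 1 3
  have h33 := hT 3 3
  simp only [kerrMetric, kerrInverse, nullPart, spherePart, Fin.sum_univ_four,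
      Fin.isValue, Matrix.of_apply, Matrix.cons_val',
      Matrix.cons_val, Matrix.cons_val_fin_one, mul_zero, zero_mul, add_zero, zero_add,
      d0, d1, d2, d3, e10, e20, e30, e21, e31, e32] at h11 h00 h01 h03 h13 h33
  obtain ⟨e12, e13, e03, e02⟩ : F 1 2 = 0 ∧ F 1 3 = a * s ^ 2 * F 0 1 ∧ F 0 3 = 0 ∧
      F 0 2 = a * s * (F 2 3 / (s * (r ^ 2 + a ^ 2))) := by
    clear hF hT d0 d1 d2 d3 e10 e20 e30 e21 e31 e32
    generalize F 0 1 = p at *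
    generalize F 0 2 = x at *
    generalize F 0 3 = y at *
    generalize F 1 2 = f₂ at *
    generalize F 1 3 = f₃ at *
    generalize F 2 3 = z at *
    -- This is T(ℓ,ℓ) = 0, because the vector dual to ℓ is ∂_r: the covector F(∂_r, ·) is null and
    -- orthogonal to ∂_r, hence a multiple of ℓ.
    have k1 : w * ((t * f₃ - a * s * p) ^ 2 + f₂ ^ 2) = 0 := by
      linear_combination h11 - 2 * a * w * p * f₃ * ht
    have k2 := (mul_eq_zero.1 k1).resolve_left hw0.ne'
    rw [add_eq_zero_iff_of_nonneg (sq_nonneg _) (sq_nonneg _)] at k2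
    have k3 : f₂ = 0 := pow_eq_zero_iff two_ne_zero |>.1 k2.2
    have k4 : t * f₃ - a * s * p = 0 := pow_eq_zero_iff two_ne_zero |>.1 k2.1
    have k5 : f₃ = a * s ^ 2 * p := by linear_combination s * k4 - f₃ * ht
    subst k3 k5
    -- This is T(v,v) = 0 for v = (r² + a²)∂_u + a∂_φ − ½(r² + a² − h)∂_r, which is |R|² times the
    -- vector dual to n. The ∂_r∂_r term is left out since that component already vanishes.
    have comb := congrArg₂ (· + ·) (congrArg₂ (· + ·) (congrArg₂ (· + ·) (congrArg₂ (· + ·)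
      (congrArg ((r ^ 2 + a ^ 2) ^ 2 * ·) h00) (congrArg (a ^ 2 * ·) h33))
      (congrArg (2 * a * (r ^ 2 + a ^ 2) * ·) h03))
      (congrArg (-((r ^ 2 + a ^ 2) * (r ^ 2 + a ^ 2 - h)) * ·) h01))
      (congrArg (-(a * (r ^ 2 + a ^ 2 - h)) * ·) h13)
    have k6 : w * ((r ^ 2 + a ^ 2) * x - a * z) ^ 2 + t ^ 2 * y ^ 2 * (r ^ 2 + a ^ 2 * c ^ 2) = 0 := by
      refine Eq.trans ?_ (sub_eq_zero.2 comb)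
      clear comb h00 h11 h33 h03 h01 h13 k1 k2 k4
      grobner
    have k7 : ((r ^ 2 + a ^ 2) * x - a * z) ^ 2 = 0 := by
      refine (mul_eq_zero.1 (le_antisymm ?_ ?_ : w * _ = 0)).resolve_left hw0.ne'
      · have : 0 ≤ t ^ 2 * y ^ 2 * (r ^ 2 + a ^ 2 * c ^ 2) := by positivity
        linarith
      · positivity
    have k8 : y = 0 := by
      rw [k7] at k6
      have ht0 : t ≠ 0 := left_ne_zero_of_mul_eq_one ht
      have : r ^ 2 + a ^ 2 * c ^ 2 ≠ 0 := right_ne_zero_of_mul_eq_one hw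
      simpa [ht0, this] using k6
    have k9 : x = a * s * (z / (s * (r ^ 2 + a ^ 2))) := by
      field_simp
      linear_combination pow_eq_zero_iff (two_ne_zero) |>.1 k7
    exact ⟨rfl, rfl, k8, k9⟩
  ext i j
  fin_cases i <;> fin_cases j <;>
    simp only [alignedField, Fin.isValue, d0, d1, d2, d3, e10, e20, e30, e21, e31, e32, e12, e13,
      e03, e02, neg_zero, Fin.zero_eta, Fin.mk_one, Fin.reduceFinMk, Matrix.of_apply,
      Matrix.cons_val', Matrix.cons_val, Matrix.cons_val_fin_one]
  all_goals field_simp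

/-! ### The Maxwell equations of aligned fields -/

theorem det_kerrMetric {a r c s w h : ℝ} (hs : s ^ 2 = 1 - c ^ 2)
    (hw : w * (r ^ 2 + a ^ 2 * c ^ 2) = 1) :
    (kerrMetric a r c s w h).det = -(s * (r ^ 2 + a ^ 2 * c ^ 2)) ^ 2 := by
  simp [kerrMetric, Matrix.det_succ_row_zero, Fin.sum_univ_succ, Fin.succAbove]
  grobner

/-- The derivatives of the coefficients of `alignedField` with respect to `r` and `θ`. -/
def alignedFieldVar (a r c s p q : ℝ) : Fin 4 → Matrix (Fin 4) (Fin 4) ℝ :=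
  ![0,
    !![0, 0, 0, 0; 0, 0, 0, 0; 0, 0, 0, 2 * r * s * q; 0, 0, -(2 * r * s * q), 0],
    !![0, 0, a * c * q, 0;
       0, 0, 0, 2 * a * s * c * p;
       -(a * c * q), 0, 0, c * (r ^ 2 + a ^ 2) * q;
       0, -(2 * a * s * c * p), -(c * (r ^ 2 + a ^ 2) * q), 0],
    0]

/-- The derivatives of the coefficients of `alignedDensity` with respect to `r` and `θ`. -/
def alignedDensityVar (a r c s p q : ℝ) : Fin 4 → Matrix (Fin 4) (Fin 4) ℝ :=
  ![0,
    !![0, -(2 * r * s * p), 0, 0; 2 * r * s * p, 0, 0, 0; 0, 0, 0, 0; 0, 0, 0, 0],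
    !![0, -(c * (r ^ 2 + a ^ 2) * p), -(2 * a * s * c * q), 0;
       c * (r ^ 2 + a ^ 2) * p, 0, 0, a * c * p;
       2 * a * s * c * q, 0, 0, 0;
       0, -(a * c * p), 0, 0],
    0]

theorem hasDerivAt_coord (x : Coord) (i j : Fin 4) :
    HasDerivAt (fun t => Function.update x i t j) (if j = i then 1 else 0) (x i) := by
  rcases eq_or_ne j i with rfl | h
  · simpa using hasDerivAt_id' (x j)
  · simpa [h] using hasDerivAt_const (x i) (x j)

theorem hasDerivAt_sin_coord (x : Coord) (i : Fin 4) :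
    HasDerivAt (fun t => Real.sin (Function.update x i t 2))
      (Real.cos (x 2) * if 2 = i then 1 else 0) (x i) := by
  simpa using (hasDerivAt_coord x i 2).sin

theorem hasDerivAt_cos_coord (x : Coord) (i : Fin 4) :
    HasDerivAt (fun t => Real.cos (Function.update x i t 2))
      (-Real.sin (x 2) * if 2 = i then 1 else 0) (x i) := by
  simpa using (hasDerivAt_coord x i 2).cos

/-- The θ tables are linear in c, which stands there for the derivative of s. Taking c = 1 and
multiplying by s' therefore gives the chain rule along any line; the r tables contain no c, and 0 is
a placeholder. -/
theorem hasDerivAt_alignedField {a τ : ℝ} {r s p q : ℝ → ℝ} {r' s' p' q' : ℝ}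
    (hr : HasDerivAt r r' τ) (hs : HasDerivAt s s' τ) (hp : HasDerivAt p p' τ)
    (hq : HasDerivAt q q' τ) (j k : Fin 4) :
    HasDerivAt (fun t => alignedField a (r t) (s t) (p t) (q t) j k)
      (alignedField a (r τ) (s τ) p' q' j k
        + r' * alignedFieldVar a (r τ) 0 (s τ) (p τ) (q τ) 1 j k
        + s' * alignedFieldVar a (r τ) 1 (s τ) (p τ) (q τ) 2 j k) τ := by
  fin_cases j <;> fin_cases k <;>
    simp only [alignedField, alignedFieldVar, Fin.isValue, Fin.zero_eta, Fin.mk_one,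
      Fin.reduceFinMk, Matrix.of_apply, Matrix.cons_val', Matrix.cons_val,
      Matrix.cons_val_fin_one] <;>
    (apply HasDerivAt.congr_deriv
     · repeat' first
        | exact hasDerivAt_const _ _ | exact hr | exact hs | exact hp | exact hq
        | apply HasDerivAt.fun_add | apply HasDerivAt.fun_sub | apply HasDerivAt.fun_neg
        | apply HasDerivAt.fun_pow | apply HasDerivAt.fun_mul
     · try simp only [Nat.cast_ofNat, Nat.add_one_sub_one, Nat.reduceSub, pow_one]
       try ring)

theorem hasDerivAt_alignedDensity {a τ : ℝ} {r s p q : ℝ → ℝ} {r' s' p' q' : ℝ}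
    (hr : HasDerivAt r r' τ) (hs : HasDerivAt s s' τ) (hp : HasDerivAt p p' τ)
    (hq : HasDerivAt q q' τ) (j k : Fin 4) :
    HasDerivAt (fun t => alignedDensity a (r t) (s t) (p t) (q t) j k)
      (alignedDensity a (r τ) (s τ) p' q' j k
        + r' * alignedDensityVar a (r τ) 0 (s τ) (p τ) (q τ) 1 j k
        + s' * alignedDensityVar a (r τ) 1 (s τ) (p τ) (q τ) 2 j k) τ := by
  fin_cases j <;> fin_cases k <;>
    simp only [alignedDensity, alignedDensityVar, Fin.isValue, Fin.zero_eta, Fin.mk_one,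
      Fin.reduceFinMk, Matrix.of_apply, Matrix.cons_val', Matrix.cons_val,
      Matrix.cons_val_fin_one] <;>
    (apply HasDerivAt.congr_deriv
     · repeat' first
        | exact hasDerivAt_const _ _ | exact hr | exact hs | exact hp | exact hq
        | apply HasDerivAt.fun_add | apply HasDerivAt.fun_sub | apply HasDerivAt.fun_neg
        | apply HasDerivAt.fun_pow | apply HasDerivAt.fun_mul
     · try simp only [Nat.cast_ofNat, Nat.add_one_sub_one, Nat.reduceSub, pow_one]
       try ring)

/-- Differentiability along the coordinate line through `x`. -/
abbrev LineDiff (f : Coord → ℝ) (x : Coord) : Prop :=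
  ∀ i, DifferentiableAt ℝ (fun t => f (Function.update x i t)) (x i)

theorem pd_alignedField {a : ℝ} {p q : Coord → ℝ} {x : Coord} (hp : LineDiff p x)
    (hq : LineDiff q x) (i j k : Fin 4) :
    pd i (fun y => alignedField a (y 1) (Real.sin (y 2)) (p y) (q y) j k) x
      = alignedField a (x 1) (Real.sin (x 2)) (pd i p x) (pd i q x) j k
        + alignedFieldVar a (x 1) (Real.cos (x 2)) (Real.sin (x 2)) (p x) (q x) i j k := by
  have h := (hasDerivAt_alignedField (a := a) (hasDerivAt_coord x i 1) (hasDerivAt_sin_coord x i)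
    (hp i).hasDerivAt (hq i).hasDerivAt j k).deriv
  simp only [Function.update_eq_self] at h
  rw [pd, h, add_assoc]
  congr 1
  fin_cases i <;> fin_cases j <;> fin_cases k <;>
    simp only [alignedFieldVar, Matrix.zero_apply, Fin.isValue, Fin.zero_eta,
      Fin.mk_one, Fin.reduceFinMk, Matrix.of_apply, Matrix.cons_val', Matrix.cons_val,
      Matrix.cons_val_fin_one, Fin.reduceEq, if_true, if_false, mul_zero, zero_mul, add_zero,
      zero_add, mul_one, one_mul, neg_zero, mul_neg, zero_ne_one, one_ne_zero] <;>
    ring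

theorem pd_alignedDensity {a : ℝ} {p q : Coord → ℝ} {x : Coord} (hp : LineDiff p x)
    (hq : LineDiff q x) (i j k : Fin 4) :
    pd i (fun y => alignedDensity a (y 1) (Real.sin (y 2)) (p y) (q y) j k) x
      = alignedDensity a (x 1) (Real.sin (x 2)) (pd i p x) (pd i q x) j k
        + alignedDensityVar a (x 1) (Real.cos (x 2)) (Real.sin (x 2)) (p x) (q x) i j k := by
  have h := (hasDerivAt_alignedDensity (a := a) (hasDerivAt_coord x i 1)
    (hasDerivAt_sin_coord x i) (hp i).hasDerivAt (hq i).hasDerivAt j k).deriv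
  simp only [Function.update_eq_self] at h
  rw [pd, h, add_assoc]
  congr 1
  fin_cases i <;> fin_cases j <;> fin_cases k <;>
    simp only [alignedDensityVar, Matrix.zero_apply, Fin.isValue, Fin.zero_eta,
      Fin.mk_one, Fin.reduceFinMk, Matrix.of_apply, Matrix.cons_val', Matrix.cons_val,
      Matrix.cons_val_fin_one, Fin.reduceEq, if_true, if_false, mul_zero, zero_mul, add_zero,
      zero_add, mul_one, one_mul, neg_zero, mul_neg, zero_ne_one, one_ne_zero] <;>
    ring

/-- The Maxwell equations of an aligned field with partial derivatives `P`, `Q`, solved for these: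
`d (p + i q) = - 2 (p + i q) dR / R`. -/
theorem alignedField_maxwell_iff {a r c s w t p q : ℝ} (hs : s ^ 2 = 1 - c ^ 2)
    (hw : w * (r ^ 2 + a ^ 2 * c ^ 2) = 1) (ht : t * s = 1) (P Q : Fin 4 → ℝ) :
    ((∀ i j k, alignedField a r s (P i) (Q i) j k + alignedFieldVar a r c s p q i j k
        + (alignedField a r s (P j) (Q j) k i + alignedFieldVar a r c s p q j k i)
        + (alignedField a r s (P k) (Q k) i j + alignedFieldVar a r c s p q k i j) = 0) ∧
      ∀ k, ∑ i, (alignedDensity a r s (P i) (Q i) i k + alignedDensityVar a r c s p q i i k) = 0) ↔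
    P = ![0, -(2 * w * (r * p + a * c * q)), 2 * w * a * s * (a * c * p - r * q), 0] ∧
      Q = ![0, 2 * w * (a * c * p - r * q), 2 * w * a * s * (r * p + a * c * q), 0] := by
  constructor
  · rintro ⟨h, h'⟩
    have c012 := h 0 1 2
    have c013 := h 0 1 3
    have c023 := h 0 2 3
    have c123 := h 1 2 3
    have d0 := h' 0
    have d1 := h' 1
    have d2 := h' 2
    have d3 := h' 3
    clear h h'
    simp only [alignedField, alignedFieldVar, alignedDensity, alignedDensityVar,
      Fin.sum_univ_four, Matrix.zero_apply, Fin.isValue, Matrix.of_apply, Matrix.cons_val',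
      Matrix.cons_val, Matrix.cons_val_fin_one, add_zero, zero_add]
      at c012 c013 c023 c123 d0 d1 d2 d3
    -- Four of the eight equations express the φ- and θ-derivatives by the u- and r-derivatives; the
    -- other four then determine the latter.
    have hP3 : P 3 = -(a * s ^ 2 * P 0) := by linear_combination c013
    have hQ3 : Q 3 = -(a * s ^ 2 * Q 0) := by linear_combination -d2
    have hP2 : P 2 = a * s * Q 1 := by linear_combination c012
    have hQ2 : Q 2 = -(a * s * P 1) := by linear_combination d3
    rw [hP3] at d1
    rw [hQ3] at c023
    rw [hP2] at c123
    rw [hQ2] at d0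
    -- What remains is P 0 times s(r² + a² − a² s²) = s(r² + a² c²), which is invertible with
    -- inverse w t.
    have hP0 : P 0 = 0 := by
      clear c012 c013 c023 c123 d0 d2 d3 hP3 hQ3 hP2 hQ2
      grobner
    have hQ0 : Q 0 = 0 := by
      clear c012 c013 c123 d0 d1 d2 d3 hP3 hQ3 hP2 hQ2 hP0
      grobner
    have hQ1 : Q 1 = 2 * w * (a * c * p - r * q) := by
      clear c012 c013 c023 d0 d1 d2 d3 hP3 hQ3 hP2 hQ2 hP0 hQ0
      grobner
    have hP1 : P 1 = -(2 * w * (r * p + a * c * q)) := by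
      clear c012 c013 c023 c123 d1 d2 d3 hP3 hQ3 hP2 hQ2 hP0 hQ0 hQ1
      grobner
    constructor <;> ext i <;> fin_cases i <;>
      simp only [hP0, hQ0, hP1, hQ1, hP2, hQ2, hP3, hQ3, Fin.isValue, Fin.zero_eta,
        Fin.mk_one, Fin.reduceFinMk, Matrix.cons_val, mul_zero, neg_zero] <;>
      ring
  · rintro ⟨rfl, rfl⟩
    constructor
    · intro i j k
      fin_cases i <;> fin_cases j <;> fin_cases k <;>
        simp only [alignedField, alignedFieldVar, Matrix.zero_apply, Fin.isValue, Fin.zero_eta,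
          Fin.mk_one, Fin.reduceFinMk, Matrix.of_apply, Matrix.cons_val', Matrix.cons_val,
          Matrix.cons_val_fin_one] <;>
        first | ring1 | grobner
    · intro k
      fin_cases k <;>
        simp only [alignedDensity, alignedDensityVar, Fin.sum_univ_four, Matrix.zero_apply,
          Fin.isValue, Fin.zero_eta, Fin.mk_one, Fin.reduceFinMk, Matrix.of_apply,
          Matrix.cons_val', Matrix.cons_val, Matrix.cons_val_fin_one] <;>
        grobner

/-! ### Electromagnetic fields of the Kerr-Schild metric -/

theorem pd_eq_fderiv {f : Coord → ℝ} {x : Coord} (hf : DifferentiableAt ℝ f x) (i : Fin 4) :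
    pd i f x = fderiv ℝ f x (Pi.single i 1) := by
  have h := hasDerivAt_update x i (x i)
  have hf' : HasFDerivAt f (fderiv ℝ f x) (Function.update x i (x i)) := by
    rw [Function.update_eq_self]; exact hf.hasFDerivAt
  exact (hf'.comp_hasDerivAt (x i) h).deriv

theorem lineDiff_of_differentiableAt {f : Coord → ℝ} {x : Coord} (hf : DifferentiableAt ℝ f x) :
    LineDiff f x := fun i => by
  have h := (hasDerivAt_update x i (x i)).differentiableAt
  have hf' : DifferentiableAt ℝ f (Function.update x i (x i)) := by
    rwa [Function.update_eq_self]
  exact hf'.comp (x i) h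

theorem isPreconnected_region {J : Set ℝ} (hJ : IsPreconnected J) : IsPreconnected (region J) := by
  refine Convex.isPreconnected ?_
  exact (hJ.convex.linear_preimage (LinearMap.proj (R := ℝ) (φ := fun _ : Fin 4 => ℝ) 1)).inter
    ((convex_Ioo (0 : ℝ) Real.pi).linear_preimage
      (LinearMap.proj (R := ℝ) (φ := fun _ : Fin 4 => ℝ) 2))

theorem exists_const_of_pd_eq_zero {U : Set Coord} (hU : IsOpen U) (hU' : IsPreconnected U)
    {f : Coord → ℝ} (hf : DifferentiableOn ℝ f U) (h : ∀ x ∈ U, ∀ i, pd i f x = 0) :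
    ∃ k, ∀ x ∈ U, f x = k := by
  refine hU.exists_is_const_of_fderiv_eq_zero hU' hf fun x hx => ?_
  have hd := hf.differentiableAt (hU.mem_nhds hx)
  ext v
  have : fderiv ℝ f x v = ∑ i, v i * fderiv ℝ f x (Pi.single i 1) := by
    conv_lhs => rw [← Finset.univ_sum_single v, map_sum]
    refine Finset.sum_congr rfl fun i _ => ?_
    rw [← smul_eq_mul, ← map_smul, ← Pi.single_smul, smul_eq_mul, mul_one]
  rw [this]
  simp [← pd_eq_fderiv hd, h x hx]

/-- The real and (negative) imaginary parts of `1 / R²`. -/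
def coulombRe (a r c w : ℝ) : ℝ := w ^ 2 * (r ^ 2 - a ^ 2 * c ^ 2)

def coulombIm (a r c w : ℝ) : ℝ := w ^ 2 * (2 * a * r * c)

/-- The aligned field with `p + i q = (α + i β) / R²`. -/
def coulombField (a α β : ℝ) (x : Coord) : Matrix (Fin 4) (Fin 4) ℝ :=
  let u := coulombRe a (x 1) (Real.cos (x 2)) (invRsq a (x 1) (x 2))
  let v := coulombIm a (x 1) (Real.cos (x 2)) (invRsq a (x 1) (x 2))
  alignedField a (x 1) (Real.sin (x 2)) (α * u + β * v) (β * u - α * v)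

namespace IsKerrSchild

variable {a : ℝ} {J : Set ℝ} {H H₁ H₂ : ℝ → ℝ} {g : Coord → Matrix (Fin 4) (Fin 4) ℝ}
  {x : Coord} {F : Coord → Matrix (Fin 4) (Fin 4) ℝ}

/-- The volume factor cancels w t exactly, so the second Maxwell equation, like the first, does not
contain H. -/
theorem sqrt_det_mul_raise₂ (hg : IsKerrSchild a J H H₁ H₂ g) (hx : x ∈ region J) {p q : ℝ}
    (hF : F x = alignedField a (x 1) (Real.sin (x 2)) p q) (i j : Fin 4) :
    Real.sqrt |(g x).det| * raise₂ g F i j x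
      = alignedDensity a (x 1) (Real.sin (x 2)) p q i j := by
  have hw := hg.invRsq_mul hx
  have hr := hg.ne_zero hx
  have hs := sin_pos_of_mem_region hx
  have ht := inv_mul_cancel₀ hs.ne'
  have hpos : 0 < x 1 ^ 2 + a ^ 2 * Real.cos (x 2) ^ 2 := by positivity
  rw [raise₂, hg.inv hx, hF, raise_alignedField (sin_sq_eq _) hw ht, hg.eq x hx,
    det_kerrMetric (sin_sq_eq _) hw, abs_neg, abs_of_nonneg (sq_nonneg _),
    Real.sqrt_sq (by positivity)]
  linear_combination (alignedDensity a (x 1) (Real.sin (x 2)) p q i j)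
    * ((Real.sin (x 2))⁻¹ * Real.sin (x 2) * hw + ht)

theorem maxwellStress_eq (hg : IsKerrSchild a J H H₁ H₂ g) (hx : x ∈ region J) {p q : ℝ}
    (hF : F x = alignedField a (x 1) (Real.sin (x 2)) p q) (i j : Fin 4) :
    maxwellStress g F i j x = (p ^ 2 + q ^ 2) / 2 *
      (nullPart a (x 1) (Real.sin (x 2)) (invRsq a (x 1) (x 2)) (H (x 1)) i j
        + spherePart a (x 1) (Real.cos (x 2)) (Real.sin (x 2)) (invRsq a (x 1) (x 2)) i j) := by
  have hw := hg.invRsq_mul hx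
  have ht := inv_mul_cancel₀ (sin_pos_of_mem_region hx).ne'
  simp only [maxwellStress, raise₂, hg.inv hx, hF, raise_alignedField (sin_sq_eq _) hw ht]
  rw [hg.eq x hx, alignedField_invariant (sin_sq_eq _) hw ht]
  exact alignedField_stress (sin_sq_eq _) hw ht i j

theorem eq_alignedField (hg : IsKerrSchild a J H H₁ H₂ g) (hx : x ∈ region J)
    (hF : ∀ i j, F x i j = -F x j i) {κ : ℝ}
    (hT : ∀ i j, maxwellStress g F i j x = κ *
      (nullPart a (x 1) (Real.sin (x 2)) (invRsq a (x 1) (x 2)) (H (x 1)) i j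
        + spherePart a (x 1) (Real.cos (x 2)) (Real.sin (x 2)) (invRsq a (x 1) (x 2)) i j)) :
    F x = alignedField a (x 1) (Real.sin (x 2)) (F x 0 1)
      (F x 2 3 / (Real.sin (x 2) * (x 1 ^ 2 + a ^ 2))) := by
  have hw := hg.invRsq_mul hx
  have ht := inv_mul_cancel₀ (sin_pos_of_mem_region hx).ne'
  simp only [maxwellStress, hg.inv hx] at hT
  rw [hg.eq x hx] at hT
  exact eq_alignedField_of_stress (sin_sq_eq _) hw ht (hg.ne_zero hx) hF hT

/-- The equivalence serves twice: to integrate the equations for an unknown field, and to check that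
Coulomb fields solve them. -/
theorem maxwell_iff (hg : IsKerrSchild a J H H₁ H₂ g) (hx : x ∈ region J) {p q : Coord → ℝ}
    (hF : ∀ y ∈ region J, F y = alignedField a (y 1) (Real.sin (y 2)) (p y) (q y))
    (hp : LineDiff p x) (hq : LineDiff q x) :
    ((∀ i j k, pd i (fun y => F y j k) x + pd j (fun y => F y k i) x
        + pd k (fun y => F y i j) x = 0) ∧
      ∀ k, ∑ i, pd i (fun y => Real.sqrt |(g y).det| * raise₂ g F i k y) x = 0) ↔
    (fun i => pd i p x) = ![0,
        -(2 * invRsq a (x 1) (x 2) * (x 1 * p x + a * Real.cos (x 2) * q x)),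
        2 * invRsq a (x 1) (x 2) * a * Real.sin (x 2) * (a * Real.cos (x 2) * p x - x 1 * q x),
        0] ∧
      (fun i => pd i q x) = ![0,
        2 * invRsq a (x 1) (x 2) * (a * Real.cos (x 2) * p x - x 1 * q x),
        2 * invRsq a (x 1) (x 2) * a * Real.sin (x 2) * (x 1 * p x + a * Real.cos (x 2) * q x),
        0] := by
  have hU := isOpen_region hg.isOpen
  have h1 : ∀ i j k, pd i (fun y => F y j k) x = _ := fun i j k =>
    (pd_congr hU (fun y hy => by rw [hF y hy]) hx i).trans (pd_alignedField (a := a) hp hq i j k)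
  have h2 : ∀ i j k, pd i (fun y => Real.sqrt |(g y).det| * raise₂ g F j k y) x = _ :=
    fun i j k => (pd_congr hU (fun y hy => hg.sqrt_det_mul_raise₂ hy (hF y hy) j k) hx i).trans
      (pd_alignedDensity (a := a) hp hq i j k)
  simp only [h1, h2]
  exact alignedField_maxwell_iff (sin_sq_eq _) (hg.invRsq_mul hx)
    (inv_mul_cancel₀ (sin_pos_of_mem_region hx).ne') (fun i => pd i p x) (fun i => pd i q x)

/-- A Maxwell field whose stress tensor is `C / |R|⁴ (2 ℓ_(a n_b) + 2 m_(a m̄_b))` is a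
Coulomb field. -/
theorem exists_eq_coulombField (hg : IsKerrSchild a J H H₁ H₂ g) (hJ : IsConnected J)
    (hF : IsMaxwellField g (region J) F) {C : ℝ}
    (hT : ∀ x ∈ region J, ∀ i j, maxwellStress g F i j x = C * invRsq a (x 1) (x 2) ^ 2 *
      (nullPart a (x 1) (Real.sin (x 2)) (invRsq a (x 1) (x 2)) (H (x 1)) i j
        + spherePart a (x 1) (Real.cos (x 2)) (Real.sin (x 2)) (invRsq a (x 1) (x 2)) i j)) :
    ∃ α β : ℝ, α ^ 2 + β ^ 2 = 2 * C ∧ ∀ x ∈ region J, F x = coulombField a α β x := by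
  have hU := isOpen_region hg.isOpen
  set p : Coord → ℝ := fun y => F y 0 1 with hp
  set q : Coord → ℝ := fun y => F y 2 3 / (Real.sin (y 2) * (y 1 ^ 2 + a ^ 2)) with hq
  have hFpq : ∀ y ∈ region J, F y = alignedField a (y 1) (Real.sin (y 2)) (p y) (q y) :=
    fun y hy => hg.eq_alignedField hy (hF.antisymm y hy) (hT y hy)
  have hpd : ∀ x ∈ region J, DifferentiableAt ℝ p x := fun x hx =>
    ((hF.contDiff 0 1).differentiableOn one_ne_zero).differentiableAt (hU.mem_nhds hx)
  have hqd : ∀ x ∈ region J, DifferentiableAt ℝ q x := fun x hx => by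
    have h23 : DifferentiableAt ℝ (fun y => F y 2 3) x :=
      ((hF.contDiff 2 3).differentiableOn one_ne_zero).differentiableAt (hU.mem_nhds hx)
    have hs := (sin_pos_of_mem_region hx).ne'
    have hr := hg.ne_zero hx
    have hne : Real.sin (x 2) * (x 1 ^ 2 + a ^ 2) ≠ 0 := by positivity
    simp only [hq, div_eq_mul_inv]
    fun_prop (disch := assumption)
  have key := fun x (hx : x ∈ region J) => (hg.maxwell_iff hx hFpq
    (lineDiff_of_differentiableAt (hpd x hx)) (lineDiff_of_differentiableAt (hqd x hx))).1
    ⟨hF.closed x hx, hF.coclosed x hx⟩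
  -- As R² = (r² − a²c²) + 2i a r c, the expression is k₁ Re + k₂ Im of (p + iq)R². It is constant
  -- because d(p + iq) = −2(p + iq) dR/R and the chart is connected.
  have hlin : ∀ k₁ k₂ : ℝ, ∃ α, ∀ x ∈ region J,
      (k₁ * p x + k₂ * q x) * (x 1 ^ 2 - a ^ 2 * Real.cos (x 2) ^ 2)
        + (k₂ * p x - k₁ * q x) * (2 * a * x 1 * Real.cos (x 2)) = α := by
    intro k₁ k₂
    refine exists_const_of_pd_eq_zero hU (isPreconnected_region hJ.isPreconnected) ?_ ?_
    · intro x hx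
      have := hpd x hx
      have := hqd x hx
      apply DifferentiableAt.differentiableWithinAt
      fun_prop
    · intro x hx i
      have hP := congrFun (key x hx).1 i
      have hQ := congrFun (key x hx).2 i
      have hpi := (lineDiff_of_differentiableAt (hpd x hx) i).hasDerivAt
      have hqi := (lineDiff_of_differentiableAt (hqd x hx) i).hasDerivAt
      have hr := hasDerivAt_coord x i 1
      have hc := hasDerivAt_cos_coord x i
      have hw := hg.invRsq_mul hx
      have hs := sin_sq_eq (x 2)
      have hd := ((((hpi.const_mul k₁).fun_add (hqi.const_mul k₂)).fun_mul
        ((hr.fun_pow 2).fun_sub ((hc.fun_pow 2).const_mul (a ^ 2)))).fun_add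
        (((hpi.const_mul k₂).fun_sub (hqi.const_mul k₁)).fun_mul
          ((hr.const_mul (2 * a)).fun_mul hc))).deriv
      change deriv _ _ = _ at hd
      unfold pd
      rw [hd]
      simp only [Function.update_eq_self]
      change deriv (fun t => p (Function.update x i t)) (x i) = _ at hP
      change deriv (fun t => q (Function.update x i t)) (x i) = _ at hQ
      rw [hP, hQ]
      clear hd hP hQ hpi hqi hr hc
      fin_cases i <;>
        simp only [Fin.isValue, Fin.zero_eta, Fin.mk_one, Fin.reduceFinMk, Matrix.cons_val,
          Fin.reduceEq, if_true, if_false, mul_zero, zero_mul, add_zero, zero_ne_one,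
          one_ne_zero, Nat.cast_ofNat, Nat.add_one_sub_one, Nat.reduceSub, pow_one, mul_one] <;>
        grobner
  obtain ⟨α, hα⟩ := hlin 1 0
  obtain ⟨β, hβ⟩ := hlin 0 1
  have hsol : ∀ x ∈ region J,
      p x = α * coulombRe a (x 1) (Real.cos (x 2)) (invRsq a (x 1) (x 2))
        + β * coulombIm a (x 1) (Real.cos (x 2)) (invRsq a (x 1) (x 2)) ∧
      q x = β * coulombRe a (x 1) (Real.cos (x 2)) (invRsq a (x 1) (x 2))
        - α * coulombIm a (x 1) (Real.cos (x 2)) (invRsq a (x 1) (x 2)) := by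
    intro x hx
    have hw := hg.invRsq_mul hx
    rw [← hα x hx, ← hβ x hx]
    unfold coulombRe coulombIm
    clear_value p q
    clear hα hβ hlin key hpd hqd hFpq hT
    constructor <;> grobner
  refine ⟨α, β, ?_, fun x hx => ?_⟩
  -- One point suffices to find α² + β². In the ur component the null part is 1 and the spherical
  -- part 0, so (p² + q²)/2 = C w², while p² + q² = (α² + β²) w².
  · obtain ⟨r, hr⟩ := hJ.nonempty
    have hx : (![0, r, Real.pi / 2, 0] : Coord) ∈ region J :=
      ⟨hr, by constructor <;> simp <;> linarith [Real.pi_pos]⟩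
    have h1 := (hg.maxwellStress_eq hx (hFpq _ hx) 0 1).symm.trans (hT _ hx 0 1)
    have hw := hg.invRsq_mul hx
    rw [(hsol _ hx).1, (hsol _ hx).2] at h1
    generalize (![0, r, Real.pi / 2, 0] : Coord) = x at *
    simp only [nullPart, spherePart, coulombRe, coulombIm, Fin.isValue, Matrix.of_apply,
      Matrix.cons_val', Matrix.cons_val, Matrix.cons_val_fin_one] at h1
    clear hα hβ hlin key hpd hqd hFpq hT hsol
    clear_value p q
    grobner
  · rw [hFpq x hx, coulombField, (hsol x hx).1, (hsol x hx).2]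

end IsKerrSchild

/-! ### Coulomb fields as solutions, and the Einstein tensor for constant charge -/

theorem hasDerivAt_coulomb_r {a r c : ℝ} {w : ℝ → ℝ} (hw : HasDerivAt w (-2 * r * w r ^ 2) r)
    (k₁ k₂ : ℝ) (hw' : w r * (r ^ 2 + a ^ 2 * c ^ 2) = 1) :
    HasDerivAt (fun r => k₁ * coulombRe a r c (w r) + k₂ * coulombIm a r c (w r))
      (-(2 * w r * (r * (k₁ * coulombRe a r c (w r) + k₂ * coulombIm a r c (w r))
          + a * c * (k₂ * coulombRe a r c (w r) - k₁ * coulombIm a r c (w r))))) r := by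
  unfold coulombRe coulombIm
  have hi := hasDerivAt_id' r
  refine ((((hw.fun_pow 2).fun_mul ((hi.fun_pow 2).sub_const (a ^ 2 * c ^ 2))).const_mul
    k₁).fun_add (((hw.fun_pow 2).fun_mul ((hi.const_mul (2 * a)).mul_const c)).const_mul
    k₂)).congr_deriv ?_
  simp only [Nat.cast_ofNat, Nat.add_one_sub_one, Nat.reduceSub, pow_one]
  grobner

theorem hasDerivAt_coulomb_θ {a r θ : ℝ} {w : ℝ → ℝ}
    (hw : HasDerivAt w (2 * a ^ 2 * Real.cos θ * Real.sin θ * w θ ^ 2) θ)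
    (k₁ k₂ : ℝ) (hw' : w θ * (r ^ 2 + a ^ 2 * Real.cos θ ^ 2) = 1) :
    HasDerivAt (fun θ => k₁ * coulombRe a r (Real.cos θ) (w θ)
        + k₂ * coulombIm a r (Real.cos θ) (w θ))
      (2 * w θ * a * Real.sin θ * (a * Real.cos θ
          * (k₁ * coulombRe a r (Real.cos θ) (w θ) + k₂ * coulombIm a r (Real.cos θ) (w θ))
        - r * (k₂ * coulombRe a r (Real.cos θ) (w θ)
          - k₁ * coulombIm a r (Real.cos θ) (w θ)))) θ := by
  unfold coulombRe coulombIm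
  have hc := Real.hasDerivAt_cos θ
  refine ((((hw.fun_pow 2).fun_mul (((hc.fun_pow 2).const_mul (a ^ 2)).const_sub
    (r ^ 2))).const_mul k₁).fun_add (((hw.fun_pow 2).fun_mul
    (hc.const_mul (2 * a * r))).const_mul k₂)).congr_deriv ?_
  simp only [Nat.cast_ofNat, Nat.add_one_sub_one, Nat.reduceSub, pow_one]
  grobner

namespace IsKerrSchild

variable {a : ℝ} {J : Set ℝ} {H H₁ H₂ : ℝ → ℝ} {g : Coord → Matrix (Fin 4) (Fin 4) ℝ}
  {x : Coord}

/-- Multiplying α + iβ by −i sends (p, q) to (q, −p). One computation, used with (k₁, k₂) = (α, β)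
and (β, −α), therefore covers both p and q. -/
theorem pd_coulomb (hg : IsKerrSchild a J H H₁ H₂ g) (hx : x ∈ region J) (k₁ k₂ : ℝ) :
    LineDiff (fun y : Coord => k₁ * coulombRe a (y 1) (Real.cos (y 2)) (invRsq a (y 1) (y 2))
        + k₂ * coulombIm a (y 1) (Real.cos (y 2)) (invRsq a (y 1) (y 2))) x ∧
    (fun i => pd i (fun y : Coord =>
        k₁ * coulombRe a (y 1) (Real.cos (y 2)) (invRsq a (y 1) (y 2))
        + k₂ * coulombIm a (y 1) (Real.cos (y 2)) (invRsq a (y 1) (y 2))) x) =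
      let u := coulombRe a (x 1) (Real.cos (x 2)) (invRsq a (x 1) (x 2))
      let v := coulombIm a (x 1) (Real.cos (x 2)) (invRsq a (x 1) (x 2))
      let p := k₁ * u + k₂ * v
      let q := k₂ * u - k₁ * v
      ![0, -(2 * invRsq a (x 1) (x 2) * (x 1 * p + a * Real.cos (x 2) * q)),
        2 * invRsq a (x 1) (x 2) * a * Real.sin (x 2) * (a * Real.cos (x 2) * p - x 1 * q),
        0] := by
  have hw := hg.invRsq_mul hx
  have hr := hg.ne_zero hx
  have h1 := hasDerivAt_coulomb_r (hasDerivAt_invRsq_r a hr (x 2)) k₁ k₂ hw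
  have h2 := hasDerivAt_coulomb_θ (hasDerivAt_invRsq_θ a hr (x 2)) k₁ k₂ hw
  let φ : ℝ → ℝ → ℝ := fun r θ => k₁ * coulombRe a r (Real.cos θ) (invRsq a r θ)
    + k₂ * coulombIm a r (Real.cos θ) (invRsq a r θ)
  have hφ : ∀ y ∈ (Set.univ : Set Coord),
      k₁ * coulombRe a (y 1) (Real.cos (y 2)) (invRsq a (y 1) (y 2))
        + k₂ * coulombIm a (y 1) (Real.cos (y 2)) (invRsq a (y 1) (y 2)) = φ (y 1) (y 2) :=
    fun y _ => rfl
  constructor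
  · exact differentiableAt_line isOpen_univ hφ (Set.mem_univ x) h1.differentiableAt
      h2.differentiableAt
  · ext i
    rw [pd_stationary isOpen_univ hφ (Set.mem_univ x) h1 h2 i]

theorem contDiffOn_coulombField (hg : IsKerrSchild a J H H₁ H₂ g) (α β : ℝ) (i j : Fin 4) :
    ContDiffOn ℝ 1 (fun x => coulombField a α β x i j) (region J) := by
  have hw : ContDiffOn ℝ 1 (fun x : Coord => invRsq a (x 1) (x 2)) (region J) := by
    unfold invRsq
    refine ContDiffOn.inv (by fun_prop) fun x hx => ?_
    have := hg.ne_zero hx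
    positivity
  have hr : ContDiffOn ℝ 1 (fun x : Coord => x 1) (region J) := by fun_prop
  have hs : ContDiffOn ℝ 1 (fun x : Coord => Real.sin (x 2)) (region J) := by fun_prop
  have hc : ContDiffOn ℝ 1 (fun x : Coord => Real.cos (x 2)) (region J) := by fun_prop
  fin_cases i <;> fin_cases j <;>
    simp only [coulombField, alignedField, coulombRe, coulombIm, Fin.isValue, Fin.zero_eta,
      Fin.mk_one, Fin.reduceFinMk, Matrix.of_apply, Matrix.cons_val', Matrix.cons_val,
      Matrix.cons_val_fin_one] <;>
    fun_prop

theorem isMaxwellField_coulombField (hg : IsKerrSchild a J H H₁ H₂ g) (α β : ℝ) :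
    IsMaxwellField g (region J) (coulombField a α β) := by
  have key : ∀ x ∈ region J, _ := fun x hx =>
    (hg.maxwell_iff hx (F := coulombField a α β)
      (p := fun y => α * coulombRe a (y 1) (Real.cos (y 2)) (invRsq a (y 1) (y 2))
        + β * coulombIm a (y 1) (Real.cos (y 2)) (invRsq a (y 1) (y 2)))
      (q := fun y => β * coulombRe a (y 1) (Real.cos (y 2)) (invRsq a (y 1) (y 2))
        + -α * coulombIm a (y 1) (Real.cos (y 2)) (invRsq a (y 1) (y 2)))
      (fun y _ => by simp only [coulombField, neg_mul, ← sub_eq_add_neg])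
      (hg.pd_coulomb hx α β).1 (hg.pd_coulomb hx β (-α)).1).2
    ⟨by
      rw [(hg.pd_coulomb hx α β).2]
      simp only [neg_mul, ← sub_eq_add_neg],
     by
      rw [(hg.pd_coulomb hx β (-α)).2]
      ext i
      fin_cases i <;>
        simp only [Fin.isValue, Fin.zero_eta, Fin.mk_one, Fin.reduceFinMk, Matrix.cons_val] <;>
        ring⟩
  exact ⟨hg.contDiffOn_coulombField α β, fun x _ => alignedField_antisymm _ _ _ _ _,
    fun x hx => (key x hx).1, fun x hx => (key x hx).2⟩

theorem maxwellStress_coulombField (hg : IsKerrSchild a J H H₁ H₂ g) (hx : x ∈ region J)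
    (α β : ℝ) (i j : Fin 4) :
    maxwellStress g (coulombField a α β) i j x =
      (α ^ 2 + β ^ 2) / 2 * invRsq a (x 1) (x 2) ^ 2 *
      (nullPart a (x 1) (Real.sin (x 2)) (invRsq a (x 1) (x 2)) (H (x 1)) i j
        + spherePart a (x 1) (Real.cos (x 2)) (Real.sin (x 2)) (invRsq a (x 1) (x 2)) i j) := by
  rw [hg.maxwellStress_eq hx rfl i j]
  congr 1
  have hw := hg.invRsq_mul hx
  unfold coulombRe coulombIm
  grobner

/-- The Einstein tensor for charge `C`, mass `m` and cosmological constant `L`. -/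
theorem einstein_eq {L m C : ℝ} (hg : IsKerrSchild a J (fun r => 2 * m * r - C + L * r ^ 4 / 3)
      (fun r => 2 * m + 4 * L * r ^ 3 / 3) (fun r => 4 * L * r ^ 2) g) (hx : x ∈ region J)
    (i j : Fin 4) :
    ricci g i j x - (1 / 2) * ricciTrace g x * g x i j =
      -(C * invRsq a (x 1) (x 2) ^ 2 *
        (nullPart a (x 1) (Real.sin (x 2)) (invRsq a (x 1) (x 2))
            (2 * m * x 1 - C + L * x 1 ^ 4 / 3) i j
          + spherePart a (x 1) (Real.cos (x 2)) (Real.sin (x 2)) (invRsq a (x 1) (x 2)) i j)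
        + (L * x 1 ^ 4 * invRsq a (x 1) (x 2) ^ 2 *
            nullPart a (x 1) (Real.sin (x 2)) (invRsq a (x 1) (x 2))
              (2 * m * x 1 - C + L * x 1 ^ 4 / 3) i j
          - L * x 1 ^ 2 * (x 1 ^ 2 + 2 * a ^ 2 * Real.cos (x 2) ^ 2)
              * invRsq a (x 1) (x 2) ^ 2 *
            spherePart a (x 1) (Real.cos (x 2)) (Real.sin (x 2)) (invRsq a (x 1) (x 2)) i j)) := by
  have hw := hg.invRsq_mul hx
  rw [hg.ricci_eq hx, hg.ricciTrace_eq hx, hg.eq x hx, kerrMetric_eq (sin_sq_eq _) hw,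
    Matrix.sub_apply]
  -- The Einstein tensor is S·null + N·sphere with the roles of the two coefficients exchanged. Here
  -- H − rH' = −(C + L r⁴), so m cancels, and the coefficients are compared for arbitrary values of
  -- the two tensors.
  unfold ricciNull ricciSphere
  generalize nullPart a (x 1) (Real.sin (x 2)) (invRsq a (x 1) (x 2)) _ i j = N
  generalize spherePart a (x 1) (Real.cos (x 2)) (Real.sin (x 2)) (invRsq a (x 1) (x 2)) i j = S
  grobner

end IsKerrSchild

/-! ### The two families as Kerr-Schild metrics -/

/-- The rotation parameter. -/
def BlackHole.rotation : BlackHole → ℝ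
  | .reissnerNordstrom => 0
  | .kerrNewman a => a

/-- The function `H(r) = 2 M r - e²(r) + Λ* r⁴ / 3`. -/
def bigH (L M : ℝ) (Q : ℝ → ℝ) (r : ℝ) : ℝ := 2 * M * r - Q r + L * r ^ 4 / 3

/-- For fixed rotation the parameters enter through `bigH` alone, so a change of mass can compensate
a change of charge. -/
theorem metric_eq_kerrMetric (B : BlackHole) (L M : ℝ) (Q : ℝ → ℝ) {x : Coord} (hr : x 1 ≠ 0) :
    metric B L M Q x = kerrMetric B.rotation (x 1) (Real.cos (x 2)) (Real.sin (x 2))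
      (invRsq B.rotation (x 1) (x 2)) (bigH L M Q (x 1)) := by
  have hs := sin_sq_eq (x 2)
  have hw := invRsq_mul B.rotation hr (x 2)
  cases B with
  | reissnerNordstrom =>
    simp only [BlackHole.rotation] at hw ⊢
    ext i j
    fin_cases i <;> fin_cases j <;>
      simp only [metric, kerrMetric, bigH, invRsq, Fin.isValue, Fin.zero_eta,
        Fin.mk_one, Fin.reduceFinMk, Matrix.of_apply, Matrix.cons_val', Matrix.cons_val,
        Matrix.cons_val_fin_one] <;>
      field_simp <;> ring
  | kerrNewman a =>
    simp only [BlackHole.rotation] at hw ⊢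
    have hne : x 1 ^ 2 + a ^ 2 * Real.cos (x 2) ^ 2 ≠ 0 := right_ne_zero_of_mul_eq_one hw
    have hw' : (x 1 ^ 2 + a ^ 2 * Real.cos (x 2) ^ 2)⁻¹ = invRsq a (x 1) (x 2) := rfl
    ext i j
    fin_cases i <;> fin_cases j <;>
      simp only [metric, kerrMetric, bigH, div_eq_mul_inv, hw', Fin.isValue, Fin.zero_eta,
        Fin.mk_one, Fin.reduceFinMk, Matrix.of_apply, Matrix.cons_val', Matrix.cons_val,
        Matrix.cons_val_fin_one] <;>
      first | ring1 | grobner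

/-- Agreement of H with `bigH` is required only on J, since the form of the charge is known only
there; a polynomial H can then replace it. -/
theorem isKerrSchild_metric (B : BlackHole) {J : Set ℝ} (hJo : IsOpen J) (hJ0 : (0 : ℝ) ∉ J)
    {L M : ℝ} {Q H H₁ H₂ : ℝ → ℝ} (hQ : ∀ r ∈ J, bigH L M Q r = H r)
    (h₁ : ∀ r ∈ J, HasDerivAt H (H₁ r) r) (h₂ : ∀ r ∈ J, HasDerivAt H₁ (H₂ r) r) :
    IsKerrSchild B.rotation J H H₁ H₂ (metric B L M Q) where
  isOpen := hJo
  zero_notMem := hJ0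
  hasDerivAt := h₁
  hasDerivAt_deriv := h₂
  eq x hx := by
    rw [metric_eq_kerrMetric B L M Q fun h => hJ0 (h ▸ hx.1), hQ _ hx.1]

theorem Rsq_eq (B : BlackHole) (x : Coord) :
    Rsq B x = x 1 ^ 2 + B.rotation ^ 2 * Real.cos (x 2) ^ 2 := by
  cases B <;> simp [Rsq, BlackHole.rotation]

theorem bigR_eq (B : BlackHole) (x : Coord) :
    bigR B x = (x 1 : ℂ) + Complex.I * (B.rotation * Real.cos (x 2) : ℝ) := by
  cases B <;> simp [bigR, BlackHole.rotation]

theorem cosmScalar_eq (B : BlackHole) (L : ℝ) {x : Coord} (hr : x 1 ≠ 0) :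
    cosmScalar B L x = L * x 1 ^ 2 / 6 * invRsq B.rotation (x 1) (x 2) := by
  cases B with
  | reissnerNordstrom => simp [cosmScalar, BlackHole.rotation, invRsq]; field_simp
  | kerrNewman a =>
    have : x 1 ^ 2 + a ^ 2 * Real.cos (x 2) ^ 2 ≠ 0 := by positivity
    simp only [cosmScalar, BlackHole.rotation, invRsq, Rsq]; field_simp

theorem tetradL_eq (B : BlackHole) (x : Coord) (i : Fin 4) :
    tetradL B x i = ((![1, 0, 0, -(B.rotation * Real.sin (x 2) ^ 2)] : Fin 4 → ℝ) i : ℂ) := by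
  cases B <;> fin_cases i <;> simp [tetradL, BlackHole.rotation]

theorem tetradN_eq (B : BlackHole) (L M : ℝ) (Q : ℝ → ℝ) {x : Coord} (hr : x 1 ≠ 0) (i : Fin 4) :
    tetradN B L M Q x i =
      let δ := (x 1 ^ 2 + B.rotation ^ 2 - bigH L M Q (x 1)) * invRsq B.rotation (x 1) (x 2) / 2
      ((![δ, 1, 0, -(B.rotation * Real.sin (x 2) ^ 2 * δ)] : Fin 4 → ℝ) i : ℂ) := by
  cases B with
  | reissnerNordstrom =>
    fin_cases i <;>
      simp only [tetradN, BlackHole.rotation, invRsq, bigH, Fin.isValue, Fin.zero_eta,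
        Fin.mk_one, Fin.reduceFinMk, Matrix.cons_val] <;>
      norm_cast <;> (try field_simp) <;> (try ring)
  | kerrNewman a =>
    have hw := invRsq_mul a hr (x 2)
    have : x 1 ^ 2 + a ^ 2 * Real.cos (x 2) ^ 2 ≠ 0 := right_ne_zero_of_mul_eq_one hw
    fin_cases i <;>
      simp only [tetradN, BlackHole.rotation, invRsq, bigH, Fin.isValue, Fin.zero_eta,
        Fin.mk_one, Fin.reduceFinMk, Matrix.cons_val] <;>
      norm_cast <;> (try field_simp) <;> (try ring)

/-- The complex factor `-1 / (√2 R)` of `m`. -/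
def tetradFactor (B : BlackHole) (x : Coord) : ℂ := -1 / ((Real.sqrt 2 : ℝ) * bigR B x)

theorem bigR_ne_zero (B : BlackHole) {x : Coord} (hr : x 1 ≠ 0) : bigR B x ≠ 0 := by
  intro h
  have := congrArg Complex.re h
  rw [bigR_eq] at this
  simp at this
  exact hr this

theorem bigR_mul_star (B : BlackHole) (x : Coord) :
    bigR B x * star (bigR B x) = ((x 1 ^ 2 + B.rotation ^ 2 * Real.cos (x 2) ^ 2 : ℝ) : ℂ) := by
  rw [bigR_eq, Complex.star_def, Complex.mul_conj, Complex.normSq_apply]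
  congr 1
  simp [-Complex.ofReal_cos, -Complex.ofReal_mul]
  ring

theorem tetradFactor_mul_star (B : BlackHole) {x : Coord} (hr : x 1 ≠ 0) :
    tetradFactor B x * star (tetradFactor B x)
      = ((invRsq B.rotation (x 1) (x 2) / 2 : ℝ) : ℂ) := by
  have h2 : ((Real.sqrt 2 : ℝ) : ℂ) * (Real.sqrt 2 : ℝ) = 2 := by
    rw [← Complex.ofReal_mul, Real.mul_self_sqrt zero_le_two]; norm_num
  have hb := bigR_mul_star B x
  have : tetradFactor B x * star (tetradFactor B x)
      = 1 / ((((Real.sqrt 2 : ℝ) : ℂ) * (Real.sqrt 2 : ℝ)) * (bigR B x * star (bigR B x))) := by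
    simp only [tetradFactor, star_div₀, star_mul, star_neg, star_one, Complex.star_def,
      Complex.conj_ofReal]
    rw [div_mul_div_comm]
    congr 1 <;> ring
  rw [this, h2, hb]
  unfold invRsq
  push_cast
  rw [one_div, mul_inv, div_eq_mul_inv, mul_comm]

/-- With m = k(A + iD) for real covectors A and D, products of m and m̄ involve k only through |k|²
= 1/(2|R|²), and the phase of R disappears. -/
theorem tetradM_eq (B : BlackHole) {x : Coord} (hr : x 1 ≠ 0) (i : Fin 4) :
    tetradM B x i = tetradFactor B x *
      (((![0, 0, x 1 ^ 2 + B.rotation ^ 2 * Real.cos (x 2) ^ 2, 0] : Fin 4 → ℝ) i : ℂ)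
        + Complex.I * ((![-(B.rotation * Real.sin (x 2)), 0, 0,
            (x 1 ^ 2 + B.rotation ^ 2) * Real.sin (x 2)] : Fin 4 → ℝ) i : ℂ)) := by
  cases B with
  | reissnerNordstrom =>
    have hr' : (x 1 : ℂ) ≠ 0 := by exact_mod_cast hr
    have h2 : ((Real.sqrt 2 : ℝ) : ℂ) ≠ 0 := by simp
    fin_cases i <;>
      simp only [tetradM, tetradFactor, BlackHole.rotation, bigR, Fin.isValue, Fin.zero_eta,
        Fin.mk_one, Fin.reduceFinMk, Matrix.cons_val] <;>
      push_cast <;> field_simp <;> (try ring)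
  | kerrNewman a =>
    fin_cases i <;>
      simp only [tetradM, tetradFactor, BlackHole.rotation, Rsq, Fin.isValue, Fin.zero_eta,
        Fin.mk_one, Fin.reduceFinMk, Matrix.cons_val] <;>
      push_cast <;> ring

theorem cosmStress_eq (B : BlackHole) (L M : ℝ) (Q : ℝ → ℝ) {x : Coord} (hr : x 1 ≠ 0)
    (i j : Fin 4) :
    cosmStress B L M Q i j x =
      let a := B.rotation
      let w := invRsq a (x 1) (x 2)
      ((L * x 1 ^ 4 * w ^ 2 * nullPart a (x 1) (Real.sin (x 2)) w (bigH L M Q (x 1)) i j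
        - L * x 1 ^ 2 * (x 1 ^ 2 + 2 * a ^ 2 * Real.cos (x 2) ^ 2) * w ^ 2 *
            spherePart a (x 1) (Real.cos (x 2)) (Real.sin (x 2)) w i j : ℝ) : ℂ) := by
  have hw := invRsq_mul B.rotation hr (x 2)
  have hne : x 1 ^ 2 + B.rotation ^ 2 * Real.cos (x 2) ^ 2 ≠ 0 := right_ne_zero_of_mul_eq_one hw
  have hk := tetradFactor_mul_star B hr
  have hI := Complex.I_sq
  have hρ : L * x 1 ^ 4 / Rsq B x ^ 2 = L * x 1 ^ 4 * invRsq B.rotation (x 1) (x 2) ^ 2 := by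
    rw [Rsq_eq, invRsq]; field_simp
  have hp : -L * x 1 ^ 2 * (2 * Rsq B x - x 1 ^ 2) / Rsq B x ^ 2 =
      -(L * x 1 ^ 2 * (x 1 ^ 2 + 2 * B.rotation ^ 2 * Real.cos (x 2) ^ 2)
        * invRsq B.rotation (x 1) (x 2) ^ 2) := by
    rw [Rsq_eq, invRsq]; field_simp; ring
  have hnull : tetradL B x i * tetradN B L M Q x j + tetradN B L M Q x i * tetradL B x j
      = ((nullPart B.rotation (x 1) (Real.sin (x 2)) (invRsq B.rotation (x 1) (x 2))
          (bigH L M Q (x 1)) i j : ℝ) : ℂ) := by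
    simp only [tetradL_eq, tetradN_eq B L M Q hr]
    norm_cast
    fin_cases i <;> fin_cases j <;>
      simp only [nullPart, Fin.isValue, Fin.zero_eta, Fin.mk_one, Fin.reduceFinMk,
        Matrix.of_apply, Matrix.cons_val', Matrix.cons_val, Matrix.cons_val_fin_one] <;>
      ring
  have hsphere : tetradM B x i * star (tetradM B x j) + star (tetradM B x i) * tetradM B x j
      = ((spherePart B.rotation (x 1) (Real.cos (x 2)) (Real.sin (x 2))
          (invRsq B.rotation (x 1) (x 2)) i j : ℝ) : ℂ) := by
    simp only [tetradM_eq B hr, star_mul, star_add, Complex.star_def, Complex.conj_ofReal,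
      Complex.conj_I]
    rw [Complex.star_def] at hk
    generalize tetradFactor B x = k at *
    generalize (starRingEnd ℂ) k = k' at *
    set A : Fin 4 → ℝ := ![0, 0, x 1 ^ 2 + B.rotation ^ 2 * Real.cos (x 2) ^ 2, 0] with hA
    set D : Fin 4 → ℝ := ![-(B.rotation * Real.sin (x 2)), 0, 0,
      (x 1 ^ 2 + B.rotation ^ 2) * Real.sin (x 2)] with hD
    have : spherePart B.rotation (x 1) (Real.cos (x 2)) (Real.sin (x 2))
        (invRsq B.rotation (x 1) (x 2)) i j
        = invRsq B.rotation (x 1) (x 2) * (A i * A j + D i * D j) := by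
      rw [hA, hD]
      fin_cases i <;> fin_cases j <;>
        simp only [spherePart, Fin.isValue, Fin.zero_eta, Fin.mk_one, Fin.reduceFinMk,
          Matrix.of_apply, Matrix.cons_val', Matrix.cons_val, Matrix.cons_val_fin_one] <;>
        first | ring1 | grobner
    rw [this]
    push_cast at hk ⊢
    linear_combination (2 * (A i * A j : ℂ) - 2 * Complex.I ^ 2 * (D i * D j)) * hk
      - (invRsq B.rotation (x 1) (x 2) : ℂ) * (D i * D j) * hI
  simp only [cosmStress]
  rw [hnull, hsphere, hρ, hp]
  push_cast
  ring

/-! ### The Maxwell scalar -/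

theorem raise_ofReal (g : Matrix (Fin 4) (Fin 4) ℝ) (v : Fin 4 → ℝ) (i : Fin 4) :
    raise g (fun j => (v j : ℂ)) i = ((g⁻¹.mulVec v i : ℝ) : ℂ) := by
  simp [raise, Matrix.mulVec, dotProduct]

theorem raise_complex (g : Matrix (Fin 4) (Fin 4) ℝ) (k z : ℂ) (v v' : Fin 4 → ℝ) (i : Fin 4) :
    raise g (fun j => k * ((v j : ℂ) + z * (v' j : ℂ))) i
      = k * (((g⁻¹.mulVec v i : ℝ) : ℂ) + z * ((g⁻¹.mulVec v' i : ℝ) : ℂ)) := by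
  simp only [← raise_ofReal, raise, mul_add, Finset.mul_sum, ← Finset.sum_add_distrib]
  refine Finset.sum_congr rfl fun j _ => ?_
  ring

theorem kerrInverse_mulVec_l {a r c s w t h : ℝ} (hs : s ^ 2 = 1 - c ^ 2)
    (hw : w * (r ^ 2 + a ^ 2 * c ^ 2) = 1) (ht : t * s = 1) :
    (kerrInverse a r s w t h).mulVec ![1, 0, 0, -(a * s ^ 2)] = ![0, 1, 0, 0] := by
  ext i
  fin_cases i <;>
    simp only [kerrInverse, Matrix.mulVec, dotProduct, Fin.sum_univ_four, Fin.isValue,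
      Fin.zero_eta, Fin.mk_one, Fin.reduceFinMk, Matrix.of_apply, Matrix.cons_val',
      Matrix.cons_val, Matrix.cons_val_fin_one] <;>
    grobner

theorem kerrInverse_mulVec_n {a r c s w t h : ℝ} (hs : s ^ 2 = 1 - c ^ 2)
    (hw : w * (r ^ 2 + a ^ 2 * c ^ 2) = 1) (ht : t * s = 1) :
    (kerrInverse a r s w t h).mulVec ![(r ^ 2 + a ^ 2 - h) * w / 2, 1, 0,
        -(a * s ^ 2 * ((r ^ 2 + a ^ 2 - h) * w / 2))]
      = ![(r ^ 2 + a ^ 2) * w, -((r ^ 2 + a ^ 2 - h) * w / 2), 0, a * w] := by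
  ext i
  fin_cases i <;>
    simp only [kerrInverse, Matrix.mulVec, dotProduct, Fin.sum_univ_four, Fin.isValue,
      Fin.zero_eta, Fin.mk_one, Fin.reduceFinMk, Matrix.of_apply, Matrix.cons_val',
      Matrix.cons_val, Matrix.cons_val_fin_one] <;>
    grobner

theorem kerrInverse_mulVec_re_m {a r c s w t h : ℝ} (hw : w * (r ^ 2 + a ^ 2 * c ^ 2) = 1) :
    (kerrInverse a r s w t h).mulVec ![0, 0, r ^ 2 + a ^ 2 * c ^ 2, 0] = ![0, 0, -1, 0] := by
  ext i
  fin_cases i <;>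
    simp only [kerrInverse, Matrix.mulVec, dotProduct, Fin.sum_univ_four, Fin.isValue,
      Fin.zero_eta, Fin.mk_one, Fin.reduceFinMk, Matrix.of_apply, Matrix.cons_val',
      Matrix.cons_val, Matrix.cons_val_fin_one] <;>
    grobner

theorem kerrInverse_mulVec_im_m {a r c s w t h : ℝ} (hs : s ^ 2 = 1 - c ^ 2)
    (hw : w * (r ^ 2 + a ^ 2 * c ^ 2) = 1) (ht : t * s = 1) :
    (kerrInverse a r s w t h).mulVec ![-(a * s), 0, 0, (r ^ 2 + a ^ 2) * s]
      = ![-(a * s), 0, 0, -t] := by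
  ext i
  fin_cases i <;>
    simp only [kerrInverse, Matrix.mulVec, dotProduct, Fin.sum_univ_four, Fin.isValue,
      Fin.zero_eta, Fin.mk_one, Fin.reduceFinMk, Matrix.of_apply, Matrix.cons_val',
      Matrix.cons_val, Matrix.cons_val_fin_one] <;>
    grobner

/-- F(ℓ, n) = −p and F(m̄, m) = iq once indices are raised; half their sum is the scalar. -/
theorem maxwellScalar_alignedField {B : BlackHole} {J : Set ℝ} {H H₁ H₂ : ℝ → ℝ} {L M : ℝ}
    {Q : ℝ → ℝ} (hg : IsKerrSchild B.rotation J H H₁ H₂ (metric B L M Q)) {x : Coord}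
    (hx : x ∈ region J) (hQ : bigH L M Q (x 1) = H (x 1))
    {F : Coord → Matrix (Fin 4) (Fin 4) ℝ} {p q : ℝ}
    (hF : F x = alignedField B.rotation (x 1) (Real.sin (x 2)) p q) :
    maxwellScalar B L M Q F x = -(1 / 2) * ((p : ℂ) - Complex.I * q) := by
  have hs := sin_sq_eq (x 2)
  have hw := hg.invRsq_mul hx
  have ht := inv_mul_cancel₀ (sin_pos_of_mem_region hx).ne'
  have hr := hg.ne_zero hx
  have hk := tetradFactor_mul_star B hr
  have hI := Complex.I_sq
  have hl : raise (metric B L M Q x) (tetradL B x) = fun i =>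
      ((![0, 1, 0, 0] : Fin 4 → ℝ) i : ℂ) := by
    ext i
    rw [funext (tetradL_eq B x), raise_ofReal, hg.inv hx, kerrInverse_mulVec_l hs hw ht]
  have hn : raise (metric B L M Q x) (tetradN B L M Q x) = fun i =>
      ((![(x 1 ^ 2 + B.rotation ^ 2) * invRsq B.rotation (x 1) (x 2),
        -((x 1 ^ 2 + B.rotation ^ 2 - H (x 1)) * invRsq B.rotation (x 1) (x 2) / 2), 0,
        B.rotation * invRsq B.rotation (x 1) (x 2)] : Fin 4 → ℝ) i : ℂ) := by
    ext i
    rw [funext (tetradN_eq B L M Q hr)]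
    simp only [hQ]
    rw [raise_ofReal, hg.inv hx, kerrInverse_mulVec_n hs hw ht]
  have hm : raise (metric B L M Q x) (tetradM B x) = fun i => tetradFactor B x *
      (((![0, 0, -1, 0] : Fin 4 → ℝ) i : ℂ) + Complex.I *
        ((![-(B.rotation * Real.sin (x 2)), 0, 0, -(Real.sin (x 2))⁻¹] : Fin 4 → ℝ) i : ℂ)) := by
    ext i
    rw [funext (tetradM_eq B hr), raise_complex, hg.inv hx, kerrInverse_mulVec_re_m hw,
      kerrInverse_mulVec_im_m hs hw ht]
  have hmb : raise (metric B L M Q x) (fun i => star (tetradM B x i)) = fun i =>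
      star (tetradFactor B x) *
      (((![0, 0, -1, 0] : Fin 4 → ℝ) i : ℂ) + -Complex.I *
        ((![-(B.rotation * Real.sin (x 2)), 0, 0, -(Real.sin (x 2))⁻¹] : Fin 4 → ℝ) i : ℂ)) := by
    have : (fun i => star (tetradM B x i)) = fun i => star (tetradFactor B x) *
        (((![0, 0, x 1 ^ 2 + B.rotation ^ 2 * Real.cos (x 2) ^ 2, 0] : Fin 4 → ℝ) i : ℂ)
        + -Complex.I * ((![-(B.rotation * Real.sin (x 2)), 0, 0,
            (x 1 ^ 2 + B.rotation ^ 2) * Real.sin (x 2)] : Fin 4 → ℝ) i : ℂ)) := by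
      ext i
      rw [tetradM_eq B hr]
      simp only [star_mul', star_add, Complex.star_def, Complex.conj_ofReal, Complex.conj_I]
    ext i
    rw [this, raise_complex, hg.inv hx, kerrInverse_mulVec_re_m hw,
      kerrInverse_mulVec_im_m hs hw ht]
  simp only [maxwellScalar]
  rw [hl, hn, hm, hmb, hF]
  clear hl hn hm hmb
  generalize tetradFactor B x = k at *
  generalize star k = k' at *
  generalize invRsq B.rotation (x 1) (x 2) = w at *
  generalize (Real.sin (x 2))⁻¹ = t at *
  generalize Real.sin (x 2) = s at *
  generalize Real.cos (x 2) = c at *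
  generalize B.rotation = a at *
  generalize x 1 = r at *
  simp only [alignedField, Fin.sum_univ_four, Fin.isValue, Matrix.of_apply, Matrix.cons_val',
    Matrix.cons_val, Matrix.cons_val_fin_one]
  have hs' : (s : ℂ) ^ 2 = 1 - (c : ℂ) ^ 2 := by exact_mod_cast hs
  have hw' : (w : ℂ) * ((r : ℂ) ^ 2 + (a : ℂ) ^ 2 * (c : ℂ) ^ 2) = 1 := by exact_mod_cast hw
  have ht' : (t : ℂ) * s = 1 := by exact_mod_cast ht
  push_cast at hk ⊢
  clear hs hw ht hg hx hQ hF hr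
  grobner

theorem maxwellScalar_coulombField {B : BlackHole} {J : Set ℝ} {H H₁ H₂ : ℝ → ℝ} {L M : ℝ}
    {Q : ℝ → ℝ} (hg : IsKerrSchild B.rotation J H H₁ H₂ (metric B L M Q)) {x : Coord}
    (hx : x ∈ region J) (hQ : bigH L M Q (x 1) = H (x 1))
    {F : Coord → Matrix (Fin 4) (Fin 4) ℝ} {α β : ℝ} (hF : F x = coulombField B.rotation α β x) :
    maxwellScalar B L M Q F x
      = -(1 / 2) * ((α : ℂ) - Complex.I * β) / star (bigR B x) ^ 2 := by
  have hR : star (bigR B x) ≠ 0 := star_ne_zero.2 (bigR_ne_zero B (hg.ne_zero hx))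
  have hw := hg.invRsq_mul hx
  have hI := Complex.I_sq
  rw [maxwellScalar_alignedField hg hx hQ hF, eq_div_iff (pow_ne_zero 2 hR), bigR_eq]
  simp only [star_add, star_mul', Complex.star_def, Complex.conj_ofReal, Complex.conj_I]
  unfold coulombRe coulombIm
  have hw' : (invRsq B.rotation (x 1) (x 2) : ℂ) * ((x 1 : ℂ) ^ 2
    + (B.rotation : ℂ) ^ 2 * (Real.cos (x 2) : ℂ) ^ 2) = 1 := by exact_mod_cast hw
  rw [Complex.ofReal_mul]
  simp only [Complex.ofReal_sub, Complex.ofReal_add, Complex.ofReal_mul, Complex.ofReal_pow,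
    Complex.ofReal_ofNat]
  clear hw hR hF hQ hx hg
  grobner

/-- The Maxwell scalar for squared charge `2 m₁ r + C`. -/
theorem hasMaxwellScalarForm (B : BlackHole) {J : Set ℝ} (hJo : IsOpen J) (hJc : IsConnected J)
    (hJ0 : (0 : ℝ) ∉ J) (L M : ℝ) {Q : ℝ → ℝ} {m₁ C : ℝ}
    (hQ : ∀ r ∈ J, Q r = 2 * m₁ * r + C) : HasMaxwellScalarForm B J L M Q C := by
  have hH : ∀ r ∈ J, bigH L M Q r = 2 * (M - m₁) * r - C + L * r ^ 4 / 3 := fun r hr => by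
    rw [bigH, hQ r hr]; ring
  have hg : IsKerrSchild B.rotation J (fun r => 2 * (M - m₁) * r - C + L * r ^ 4 / 3)
      (fun r => 2 * (M - m₁) + 4 * L * r ^ 3 / 3) (fun r => 4 * L * r ^ 2) (metric B L M Q) := by
    refine isKerrSchild_metric B hJo hJ0 hH (fun r _ => ?_) fun r _ => ?_
    · have h := ((((hasDerivAt_id' r).const_mul (2 * (M - m₁))).sub_const C).fun_add
        ((((hasDerivAt_id' r).fun_pow 4).const_mul L).div_const 3))
      refine h.congr_deriv ?_
      simp only [Nat.cast_ofNat, Nat.reduceSub]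
      ring
    · have h := ((((hasDerivAt_id' r).fun_pow 3).const_mul (4 * L)).div_const 3).const_add
        (2 * (M - m₁))
      refine h.congr_deriv ?_
      simp only [Nat.cast_ofNat, Nat.reduceSub]
      ring
  -- The cosmological stress cancels the L terms of the Einstein tensor exactly, so the Einstein
  -- equation is a condition on the Maxwell stress alone.
  have einstein : ∀ (F : Coord → Matrix (Fin 4) (Fin 4) ℝ), ∀ x ∈ region J, ∀ i j,
      ((ricci (metric B L M Q) i j x
        - (1 / 2) * ricciTrace (metric B L M Q) x * metric B L M Q x i j : ℝ) : ℂ)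
      = - (((maxwellStress (metric B L M Q) F i j x : ℝ) : ℂ) + cosmStress B L M Q i j x) ↔
      maxwellStress (metric B L M Q) F i j x = C * invRsq B.rotation (x 1) (x 2) ^ 2 *
        (nullPart B.rotation (x 1) (Real.sin (x 2)) (invRsq B.rotation (x 1) (x 2))
            (2 * (M - m₁) * x 1 - C + L * x 1 ^ 4 / 3) i j
          + spherePart B.rotation (x 1) (Real.cos (x 2)) (Real.sin (x 2))
            (invRsq B.rotation (x 1) (x 2)) i j) := by
    intro F x hx i j
    rw [hg.einstein_eq hx, cosmStress_eq B L M Q (hg.ne_zero hx), hH _ hx.1]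
    simp only
    rw [← Complex.ofReal_add, ← Complex.ofReal_neg, Complex.ofReal_inj, neg_inj,
      add_left_inj, eq_comm]
  have h2 : ((Real.sqrt 2 : ℝ) : ℂ) ≠ 0 := by simp
  have h22 : ((Real.sqrt 2 : ℝ) : ℂ) ^ 2 = 2 := by
    rw [← Complex.ofReal_pow, Real.sq_sqrt zero_le_two]; norm_num
  constructor
  · intro F hF
    obtain ⟨α, β, hαβ, hsol⟩ := hg.exists_eq_coulombField hJc hF.maxwell
      fun x hx i j => (einstein F x hx i j).1 (hF.einstein x hx i j)
    have hC : 0 ≤ C := by nlinarith [sq_nonneg α, sq_nonneg β]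
    refine ⟨hC, ?_⟩
    obtain ⟨ω, hω, hωC⟩ : ∃ ω : ℂ, ‖ω‖ = 1 ∧
        -(1 / 2) * ((α : ℂ) - Complex.I * β) = ω * ((Real.sqrt C : ℝ) / (Real.sqrt 2 : ℝ)) := by
      rcases hC.eq_or_lt with rfl | hC
      -- For C = 0 the field vanishes and any phase would do.
      · have hα : α = 0 := by nlinarith [sq_nonneg α, sq_nonneg β]
        have hβ : β = 0 := by nlinarith [sq_nonneg α, sq_nonneg β]
        exact ⟨1, norm_one, by simp [hα, hβ]⟩
      · have hsC : ((Real.sqrt C : ℝ) : ℂ) ≠ 0 := by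
          simpa using (Real.sqrt_pos.2 hC).ne'
        -- The number solves the required equation for ω; its modulus is 1 because |α − iβ|² = 2C.
        refine ⟨-((α : ℂ) - Complex.I * β) / ((Real.sqrt 2 : ℝ) * (Real.sqrt C : ℝ)), ?_, ?_⟩
        · have hn : ‖(α : ℂ) - Complex.I * β‖ = Real.sqrt (2 * C) := by
            rw [Complex.norm_def, Complex.normSq_apply]
            congr 1
            simp
            linarith
          rw [norm_div, norm_neg, hn, norm_mul, Complex.norm_real, Complex.norm_real,
            Real.norm_of_nonneg (Real.sqrt_nonneg _), Real.norm_of_nonneg (Real.sqrt_nonneg _),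
            ← Real.sqrt_mul zero_le_two, div_self]
          exact (Real.sqrt_pos.2 (by positivity)).ne'
        · field_simp
          rw [h22]
          ring
    refine ⟨ω, hω, fun x hx => ?_⟩
    rw [maxwellScalar_coulombField hg hx (hH _ hx.1) (hsol x hx), hωC]
    ring
  · intro e₀ he
    -- The scalar of a Coulomb field is −½(α − iβ)/R̄², so α = −√2 e₀, β = 0 gives e₀/(√2 R̄²).
    refine ⟨coulombField B.rotation (-(Real.sqrt 2 * e₀)) 0,
      ⟨hg.isMaxwellField_coulombField _ _, fun x hx i j => (einstein _ x hx i j).2 ?_⟩,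
      fun x hx => ?_⟩
    · rw [hg.maxwellStress_coulombField hx]
      congr 2
      rw [neg_sq, mul_pow, Real.sq_sqrt zero_le_two, he]
      ring
    · rw [maxwellScalar_coulombField hg hx (hH _ hx.1) rfl]
      have hR : star (bigR B x) ≠ 0 := star_ne_zero.2 (bigR_ne_zero B (hg.ne_zero hx))
      push_cast
      field_simp
      linear_combination (e₀ : ℂ) * h22

/-! ### The Ricci scalar -/

theorem hasDerivAt_deriv_of_contDiffOn_two {J : Set ℝ} (hJ : IsOpen J) {e : ℝ → ℝ}
    (he : ContDiffOn ℝ 2 e J) {r : ℝ} (hr : r ∈ J) :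
    HasDerivAt e (deriv e r) r ∧ HasDerivAt (deriv e) (deriv (deriv e) r) r := by
  refine ⟨((he.differentiableOn two_ne_zero).differentiableAt (hJ.mem_nhds hr)).hasDerivAt, ?_⟩
  have h : ContDiffOn ℝ 1 (deriv e) J := he.deriv_of_isOpen hJ (by norm_num)
  exact ((h.differentiableOn one_ne_zero).differentiableAt (hJ.mem_nhds hr)).hasDerivAt

/-- Λ = H''/(24|R|²) with H'' = 4Lr² − (e²)'' and (e²)'' = 2(e'² + e e''). -/
theorem ricciScalar_charged (B : BlackHole) {J : Set ℝ} (hJo : IsOpen J) (hJ0 : (0 : ℝ) ∉ J)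
    (L M : ℝ) {e : ℝ → ℝ} (he : ContDiffOn ℝ 2 e J) {x : Coord} (hx : x ∈ region J) :
    ricciScalar (metric B L M fun r => e r ^ 2) x = cosmScalar B L x
      - (deriv e (x 1) ^ 2 + e (x 1) * deriv (deriv e) (x 1)) / (12 * Rsq B x) := by
  have hg : IsKerrSchild B.rotation J (bigH L M fun r => e r ^ 2)
      (fun r => 2 * M - 2 * e r * deriv e r + 4 * L * r ^ 3 / 3)
      (fun r => -2 * (deriv e r ^ 2 + e r * deriv (deriv e) r) + 4 * L * r ^ 2)
      (metric B L M fun r => e r ^ 2) := by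
    refine isKerrSchild_metric B hJo hJ0 (fun _ _ => rfl) (fun r hr => ?_) fun r hr => ?_
    all_goals obtain ⟨h, h'⟩ := hasDerivAt_deriv_of_contDiffOn_two hJo he hr
    · have h := (((hasDerivAt_id' r).const_mul (2 * M)).fun_sub (h.fun_pow 2)).fun_add
        ((((hasDerivAt_id' r).fun_pow 4).const_mul L).div_const 3)
      refine h.congr_deriv ?_
      simp only [Nat.cast_ofNat, Nat.reduceSub]
      ring
    · have h := (((h.const_mul 2).fun_mul h').const_sub (2 * M)).fun_add
        ((((hasDerivAt_id' r).fun_pow 3).const_mul (4 * L)).div_const 3)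
      refine h.congr_deriv ?_
      simp only [Nat.cast_ofNat, Nat.reduceSub]
      ring
  have hr := hg.ne_zero hx
  rw [ricciScalar, hg.ricciTrace_eq hx, cosmScalar_eq B L hr, Rsq_eq, div_eq_mul_inv _ (12 * _),
    mul_inv]
  change _ = _ - _ * (12⁻¹ * invRsq B.rotation (x 1) (x 2))
  ring

theorem emScalar_charged (B : BlackHole) {J : Set ℝ} (hJo : IsOpen J) (hJ0 : (0 : ℝ) ∉ J)
    (L M : ℝ) {e : ℝ → ℝ} (he : ContDiffOn ℝ 2 e J) {x : Coord} (hx : x ∈ region J) :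
    emScalar B L M (fun r => e r ^ 2) x
      = -(deriv e (x 1) ^ 2 + e (x 1) * deriv (deriv e) (x 1)) / (12 * Rsq B x) := by
  rw [emScalar, ricciScalar_charged B hJo hJ0 L M he hx]
  ring

/-- Proved apart from the charged case because C may be negative and then is no square. -/
theorem ricciScalar_const (B : BlackHole) {J : Set ℝ} (hJo : IsOpen J) (hJ0 : (0 : ℝ) ∉ J)
    (L M C : ℝ) {x : Coord} (hx : x ∈ region J) :
    ricciScalar (metric B L M fun _ => C) x = cosmScalar B L x := by
  have hg : IsKerrSchild B.rotation J (bigH L M fun _ => C)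
      (fun r => 2 * M + 4 * L * r ^ 3 / 3) (fun r => 4 * L * r ^ 2)
      (metric B L M fun _ => C) := by
    refine isKerrSchild_metric B hJo hJ0 (fun _ _ => rfl) (fun r hr => ?_) fun r hr => ?_
    · have h := (((hasDerivAt_id' r).const_mul (2 * M)).sub_const C).fun_add
        ((((hasDerivAt_id' r).fun_pow 4).const_mul L).div_const 3)
      refine h.congr_deriv ?_
      simp only [Nat.cast_ofNat, Nat.reduceSub]
      ring
    · have h := ((((hasDerivAt_id' r).fun_pow 3).const_mul (4 * L)).div_const 3).const_add (2 * M)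
      refine h.congr_deriv ?_
      simp only [Nat.cast_ofNat, Nat.reduceSub]
      ring
  rw [ricciScalar, hg.ricciTrace_eq hx, cosmScalar_eq B L (hg.ne_zero hx)]
  ring

theorem exists_mem_region {J : Set ℝ} {r : ℝ} (hr : r ∈ J) :
    ∃ x ∈ region J, x 1 = r :=
  ⟨![0, r, Real.pi / 2, 0], ⟨hr, by constructor <;> simp <;> linarith [Real.pi_pos]⟩, rfl⟩

/-- A function on an interval is affine if and only if its second derivative vanishes; here for
the square of `e`. -/
theorem sq_affine_iff {J : Set ℝ} (hJo : IsOpen J) (hJc : IsConnected J) {e : ℝ → ℝ}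
    (he : ContDiffOn ℝ 2 e J) :
    (∀ r ∈ J, deriv e r ^ 2 + e r * deriv (deriv e) r = 0) ↔
      ∃ m₁ C : ℝ, ∀ r ∈ J, e r ^ 2 = 2 * m₁ * r + C := by
  have hd : ∀ r ∈ J, HasDerivAt (fun r => e r ^ 2) (2 * e r * deriv e r) r := fun r hr => by
    refine ((hasDerivAt_deriv_of_contDiffOn_two hJo he hr).1.fun_pow 2).congr_deriv ?_
    simp
  have hd' : ∀ r ∈ J, HasDerivAt (fun r => 2 * e r * deriv e r)
      (2 * (deriv e r ^ 2 + e r * deriv (deriv e) r)) r := fun r hr => by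
    obtain ⟨h, h'⟩ := hasDerivAt_deriv_of_contDiffOn_two hJo he hr
    refine ((h.const_mul 2).fun_mul h').congr_deriv ?_
    ring
  constructor
  · intro h
    obtain ⟨k, hk⟩ := hJo.exists_is_const_of_deriv_eq_zero hJc.isPreconnected
      (fun r hr => (hd' r hr).differentiableAt.differentiableWithinAt)
      fun r hr => by rw [(hd' r hr).deriv, h r hr]; simp
    obtain ⟨C, hC⟩ := hJo.exists_is_const_of_deriv_eq_zero (f := fun r => e r ^ 2 - k * r)
      hJc.isPreconnected
      (fun r hr => ((hd r hr).fun_sub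
        ((hasDerivAt_id' r).const_mul k)).differentiableAt.differentiableWithinAt)
      fun r hr => by
        rw [((hd r hr).fun_sub ((hasDerivAt_id' r).const_mul k)).deriv, hk r hr]; simp
    exact ⟨k / 2, C, fun r hr => by linarith [hC r hr]⟩
  · rintro ⟨m, C, h⟩ r hr
    have h1 : ∀ r ∈ J, 2 * e r * deriv e r = 2 * m := fun r hr => by
      rw [← (hd r hr).deriv]
      have : (fun r => e r ^ 2) =ᶠ[nhds r] fun r => 2 * m * r + C := by
        filter_upwards [hJo.mem_nhds hr] with s hs using h s hs
      rw [this.deriv_eq, (((hasDerivAt_id' r).const_mul (2 * m)).add_const C).deriv, mul_one]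
    have h2 : (fun r => 2 * e r * deriv e r) =ᶠ[nhds r] fun _ => 2 * m := by
      filter_upwards [hJo.mem_nhds hr] with s hs using h1 s hs
    have h3 := (hd' r hr).deriv
    rw [h2.deriv_eq, deriv_const] at h3
    linarith

theorem emScalar_eq_zero_iff (B : BlackHole) {J : Set ℝ} (hJo : IsOpen J) (hJc : IsConnected J)
    (hJ0 : (0 : ℝ) ∉ J) (L M : ℝ) {e : ℝ → ℝ} (he : ContDiffOn ℝ 2 e J) :
    (∀ x ∈ region J, emScalar B L M (fun r => e r ^ 2) x = 0) ↔
      ∃ m₁ C : ℝ, ∀ r ∈ J, e r ^ 2 = 2 * m₁ * r + C := by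
  rw [← sq_affine_iff hJo hJc he]
  have hne : ∀ x ∈ region J, 12 * Rsq B x ≠ 0 := fun x hx => by
    have : x 1 ≠ 0 := fun h => hJ0 (h ▸ hx.1)
    rw [Rsq_eq]
    positivity
  constructor
  · intro h r hr
    obtain ⟨x, hx, rfl⟩ := exists_mem_region hr
    have h' := h x hx
    rw [emScalar_charged B hJo hJ0 L M he hx, div_eq_zero_iff, neg_eq_zero] at h'
    exact h'.resolve_right (hne x hx)
  · intro h x hx
    rw [emScalar_charged B hJo hJ0 L M he hx, h _ hx.1]
    simp

/-! ### Electrical radiation -/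

theorem eq_zero_of_quartic_eq_zero {J : Set ℝ} (hJo : IsOpen J) (hJn : J.Nonempty) {k₄ k₁ k₀ : ℝ}
    (h : ∀ r ∈ J, k₄ * r ^ 4 + k₁ * r + k₀ = 0) : k₄ = 0 ∧ k₁ = 0 ∧ k₀ = 0 := by
  have hp : Polynomial.C k₄ * Polynomial.X ^ 4 + Polynomial.C k₁ * Polynomial.X
      + Polynomial.C k₀ = 0 := by
    refine Polynomial.eq_zero_of_infinite_isRoot _
      ((infinite_of_mem_nhds _ (hJo.mem_nhds hJn.some_mem)).mono fun r hr => ?_)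
    simpa [Polynomial.IsRoot.def] using h r hr
  have h4 := congrArg (fun p => Polynomial.coeff p 4) hp
  have h1 := congrArg (fun p => Polynomial.coeff p 1) hp
  have h0 := congrArg (fun p => Polynomial.coeff p 0) hp
  simp [Polynomial.coeff_X, Polynomial.coeff_C] at h4 h1 h0
  exact ⟨h4, h1, h0⟩

/-- The uu entry 1 − H/|R|² recovers H from the metric, so equal metrics mean equal H, and the
coefficients of r⁴, r and 1 can be compared. -/
theorem isElectricalRadiation_iff (B : BlackHole) {J : Set ℝ} (hJo : IsOpen J)
    (hJc : IsConnected J) (hJ0 : (0 : ℝ) ∉ J) (L M : ℝ) {e : ℝ → ℝ} (he : ContDiffOn ℝ 2 e J)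
    {m₁ C : ℝ} (h : ∀ r ∈ J, e r ^ 2 = 2 * m₁ * r + C) (L' M' C' : ℝ) :
    IsElectricalRadiation B J L M e L' M' C' ↔ L' = L ∧ M' = M - m₁ ∧ C' = C := by
  constructor
  · intro hE
    have key : ∀ r ∈ J, (L - L') / 3 * r ^ 4 + 2 * (M - m₁ - M') * r + (C' - C) = 0 := by
      intro r hr
      obtain ⟨x, hx, rfl⟩ := exists_mem_region hr
      have hr0 : x 1 ≠ 0 := fun h => hJ0 (h ▸ hx.1)
      have h00 := congrFun (congrFun (hE.becomes x hx) 0) 0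
      rw [metric_eq_kerrMetric B _ _ _ hr0, metric_eq_kerrMetric B _ _ _ hr0] at h00
      have hw := left_ne_zero_of_mul_eq_one (invRsq_mul B.rotation hr0 (x 2))
      simp only [kerrMetric, Fin.isValue, Matrix.of_apply, Matrix.cons_val',
        Matrix.cons_val, Matrix.cons_val_fin_one, sub_right_inj] at h00
      have h00' := mul_right_cancel₀ hw h00
      simp only [bigH, h _ hr] at h00'
      linarith
    obtain ⟨h4, h1, h0⟩ := eq_zero_of_quartic_eq_zero hJo hJc.nonempty key
    exact ⟨by linarith, by linarith, by linarith⟩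
  · rintro ⟨rfl, rfl, rfl⟩
    refine ⟨he, (emScalar_eq_zero_iff B hJo hJc hJ0 L' M he).2 ⟨m₁, C', h⟩, fun x hx => ?_⟩
    have hr0 : x 1 ≠ 0 := fun h => hJ0 (h ▸ hx.1)
    rw [metric_eq_kerrMetric B _ _ _ hr0, metric_eq_kerrMetric B _ _ _ hr0]
    congr 1
    simp only [bigH, h _ hx.1]
    ring

end ChargedDeSitter

end

/-! ### The theorem, with induction over successive radiations -/

theorem theorem1 (B : ChargedDeSitter.BlackHole) (J : Set ℝ) (hJo : IsOpen J)
    (hJc : IsConnected J) (hJ0 : (0 : ℝ) ∉ J) (L M : ℝ) :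
    -- one electrical radiation
    (∀ e : ℝ → ℝ, ContDiffOn ℝ 2 e J →
      (∀ x ∈ ChargedDeSitter.region J,
        ChargedDeSitter.emScalar B L M (fun r => e r ^ 2) x
          = - (deriv e (x 1) ^ 2 + e (x 1) * deriv (deriv e) (x 1))
              / (12 * ChargedDeSitter.Rsq B x)) ∧
      ((∀ x ∈ ChargedDeSitter.region J,
          ChargedDeSitter.emScalar B L M (fun r => e r ^ 2) x = 0) ↔
        ∃ m₁ C : ℝ, ∀ r ∈ J, e r ^ 2 = 2 * m₁ * r + C) ∧
      (∀ m₁ C : ℝ, (∀ r ∈ J, e r ^ 2 = 2 * m₁ * r + C) →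
        (∀ L' M' C' : ℝ, ChargedDeSitter.IsElectricalRadiation B J L M e L' M' C' ↔
          L' = L ∧ M' = M - m₁ ∧ C' = C) ∧
        (∀ x ∈ ChargedDeSitter.region J,
          ChargedDeSitter.ricciScalar (ChargedDeSitter.metric B L M (fun r => e r ^ 2)) x
            = ChargedDeSitter.cosmScalar B L x) ∧
        ChargedDeSitter.HasMaxwellScalarForm B J L M (fun r => e r ^ 2) C)) ∧
    -- `n` successive electrical radiations
    (∀ (n : ℕ) (e : ℕ → ℝ → ℝ) (L' M' C : ℕ → ℝ), L' 0 = L → M' 0 = M →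
      (∀ k < n, ChargedDeSitter.IsElectricalRadiation B J (L' k) (M' k) (e k)
        (L' (k + 1)) (M' (k + 1)) (C (k + 1))) →
      ∃ m : ℕ → ℝ,
        (∀ k < n, ∀ r ∈ J, e k r ^ 2 = 2 * m k * r + C (k + 1)) ∧
        ∀ k ≤ n, L' k = L ∧ M' k = M - ∑ j ∈ Finset.range k, m j ∧
          (∀ x ∈ ChargedDeSitter.region J,
            ChargedDeSitter.ricciScalar (ChargedDeSitter.metric B (L' k) (M' k) (fun _ => C k)) x
              = ChargedDeSitter.cosmScalar B L x) ∧
          ChargedDeSitter.HasMaxwellScalarForm B J (L' k) (M' k) (fun _ => C k) (C k)) := by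
  refine ⟨fun e he => ⟨fun x hx => ?_, ?_, fun m₁ C h => ⟨?_, ?_, ?_⟩⟩, ?_⟩
  · exact ChargedDeSitter.emScalar_charged B hJo hJ0 L M he hx
  · exact ChargedDeSitter.emScalar_eq_zero_iff B hJo hJc hJ0 L M he
  · exact ChargedDeSitter.isElectricalRadiation_iff B hJo hJc hJ0 L M he h
  · intro x hx
    have h0 := (ChargedDeSitter.emScalar_eq_zero_iff B hJo hJc hJ0 L M he).2 ⟨m₁, C, h⟩ x hx
    exact sub_eq_zero.1 h0
  · exact ChargedDeSitter.hasMaxwellScalarForm B hJo hJc hJ0 L M h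
  · intro n e L' M' C hL hM hstep
    -- Stated for every k so that a total sequence can be chosen, with the value 0 from n on. Step k
    -- leads from the parameters of index k to those of index k + 1, hence the constant `C (k + 1)`.
    have hex : ∀ k, ∃ m : ℝ, k < n → (∀ r ∈ J, e k r ^ 2 = 2 * m * r + C (k + 1)) ∧
        L' (k + 1) = L' k ∧ M' (k + 1) = M' k - m := by
      intro k
      by_cases hk : k < n
      · have hE := hstep k hk
        obtain ⟨m, c, h⟩ := (ChargedDeSitter.emScalar_eq_zero_iff B hJo hJc hJ0 (L' k) (M' k)
          hE.contDiff).1 hE.vanishing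
        obtain ⟨h1, h2, h3⟩ := (ChargedDeSitter.isElectricalRadiation_iff B hJo hJc hJ0 (L' k)
          (M' k) hE.contDiff h _ _ _).1 hE
        exact ⟨m, fun _ => ⟨fun r hr => by rw [h r hr, h3], h1, h2⟩⟩
      · exact ⟨0, fun h => absurd h hk⟩
    choose m hm using hex
    refine ⟨m, fun k hk => (hm k hk).1, fun k hk => ?_⟩
    have hLM : L' k = L ∧ M' k = M - ∑ j ∈ Finset.range k, m j := by
      induction k with
      | zero => simp [hL, hM]
      | succ k ih =>
        obtain ⟨ih₁, ih₂⟩ := ih (by omega)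
        obtain ⟨-, h1, h2⟩ := hm k (by omega)
        refine ⟨h1.trans ih₁, ?_⟩
        rw [h2, ih₂, Finset.sum_range_succ]
        ring
    refine ⟨hLM.1, hLM.2, fun x hx => ?_, ?_⟩
    · rw [hLM.1]
      exact ChargedDeSitter.ricciScalar_const B hJo hJ0 L (M' k) (C k) hx
    -- A constant squared charge is the affine case with slope 0. This also covers k = 0, where no
    -- radiation has taken place.
    · exact ChargedDeSitter.hasMaxwellScalarForm B hJo hJc hJ0 (L' k) (M' k) (m₁ := 0)
        fun r _ => by ring
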